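/- **Definitions.** An *ordered factorization* of a positive integer $n$ is a finite sequence $\mathbf d=(d_1,\dots,d_\ell)$ of integers $d_i>1$ with $d_1\cdots d_\ell=n$; its *length* is $\ell$ and its *basis* is the multiset of its entries. A *refinement* of $\mathbf d$ is an ordered factorization of $n$ obtained by replacing each $d_i$ by a block of consecutive entries with product $d_i$. Two ordered factorizations $\mathbf d,\mathbf e$ of $n$ with the same basis define a unique bijection $\sigma$ of their indices with $d_i=e_{\sigma(i)}$ for all $i$ and $\sigma(i)<\sigma(j)$ whenever $i<j$ and $d_i=d_j$; they are *associated* if they have the same basis and moreover $\sigma(i)<\sigma(j)$ whenever $i<j$ and $\gcd(d_i,d_j)>1$. For a field $F$, let $\mathcal P_k$ be the set of polynomials $f\in F[x]$ that are monic of degree $k$ and original, i.e. $f(0)=0$. For a finite sequence $\mathbf d=(d_1,\dots,d_\ell)$ of positive integers with product $n$ let $$\mathcal D_{n,\mathbf d}=\{f\in\mathcal P_n : f=g_1\circ\cdots\circ g_\ell \text{ for some } g_i\in\mathcal P_{d_i},\ 1\le i\le \ell\}$$ (the empty composition being $x$), and for a nonempty set $\mathbf D$ of such sequences let $\mathcal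 D_{n,\mathbf D}=\bigcap_{\mathbf d\in\mathbf D}\mathcal D_{n,\mathbf d}$. **Algorithm.** Input: two ordered factorizations $\mathbf d=(d_1,\dots,d_\ell)$ and $\mathbf e=(e_1,\dots,e_m)$ of $n$. Start with the $\ell\times(m+1)$ matrix $(d^*_{i,j})$ and the $m\times(\ell+1)$ matrix $(e^*_{j,i})$ all of whose entries are $1$, except for the last columns, which are $d^*_{i,m+1}=d_i$ and $e^*_{j,\ell+1}=e_j$. For $i=1,\dots,\ell$, and for each $i$ for $j=1,\dots,m$, do the following: let $c\leftarrow\gcd(d^*_{i,m+1},e^*_{j,\ell+1})$, set $d^*_{i,j}\leftarrow c$ and $e^*_{j,i}\leftarrow c$, and replace $d^*_{i,m+1}$ by $d^*_{i,m+1}/c$ and $e^*_{j,\ell+1}$ by $e^*_{j,\ell+1}/c$. Finally, remove the last column of both matrices, read each of them row by row as a sequence, remove all $1$'s, and return the two resulting sequences. The first sequence returned on input $\mathbf d,\mathbf e$ is denoted by $\mathbf d/\!/\mathbf e$. **Proposition.** Let $n$ be a positive integer and let $\mathbf d$, $\mathbf e$ be two ordered factorizations of $n$ with lengths $\ell$ and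 $m$, respectively. Then the following holds. (i) On input $\mathbf d,\mathbf e$ the algorithm returns the pair $\mathbf d/\!/\mathbf e$, $\mathbf e/\!/\mathbf d$. These are a refinement of $\mathbf d$ and a refinement of $\mathbf e$, respectively, and they are associated. The algorithm uses $O(\ell m)$ gcd-computations and $O(\ell m)$ additional integer divisions, namely at most $\ell m$ and at most $2\ell m$, respectively. Let moreover $F$ be a field whose characteristic does not divide $n$ (every field of characteristic $0$ is allowed), and let all polynomials have coefficients in $F$. (ii) $\mathcal D_{n,\{\mathbf d,\mathbf e\}}=\mathcal D_{n,\{\mathbf d/\!/\mathbf e,\,\mathbf e\}}=\mathcal D_{n,\{\mathbf d/\!/\mathbf e,\,\mathbf e/\!/\mathbf d\}}$. (iii) Let $1\le i\le\ell$, $1\le j\le m$, $c=\gcd(d_i,e_j)$, and suppose that $$\gcd(d_1\cdots d_{i-1}d_i,\ e_1\cdots e_{j-1})=\gcd(d_1\cdots d_{i-1},\ e_1\cdots e_{j-1}e_j).$$ If $g_1\circ\cdots\circ g_\ell=h_1\circ\cdots\circ h_m$ with $g_k\in\mathcal P_{d_k}$ and $h_k\in\mathcal P_{e_k}$ for all $k$,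 then there are unique $u\in\mathcal P_c$ and $v\in\mathcal P_{d_i/c}$ with $g_i=u\circ v$. Therefore every $f\in\mathcal D_{n,\{\mathbf d,\mathbf e\}}$ also lies in $\mathcal D_{n,\mathbf d^*}$ for $\mathbf d^*=(d_1,\dots,d_{i-1},c,d_i/c,d_{i+1},\dots,d_\ell)$. -/

import Mathlib

/-! ### Ordered factorizations, refinements, association -/

/-- An ordered factorization of `n`: a sequence of integers greater than `1` with product `n`. -/
def IsOrderedFactorization (n : ℕ) (d : List ℕ) : Prop :=
  (∀ x ∈ d, 1 < x) ∧ d.prod = n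

/-- `IsRefinement n ds d`: the ordered factorization `ds` of `n` is obtained from `d` by replacing
every entry of `d` by a block of consecutive entries with that entry as its product. -/
def IsRefinement (n : ℕ) (ds d : List ℕ) : Prop :=
  IsOrderedFactorization n ds ∧
    ∃ blocks : List (List ℕ), ds = blocks.flatten ∧ d = blocks.map List.prod

/-- `d` and `e` have the same basis, and the bijection `σ` of their indices with `d_i = e_{σ(i)}`
that preserves the order of repeated entries (there is only one) even preserves the order of
any two entries that are not coprime. -/
def AreAssociated (d e : List ℕ) : Prop :=
  ∃ σ : Fin d.length ≃ Fin e.length,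
    (∀ i, d.get i = e.get (σ i)) ∧
    (∀ i j, i < j → d.get i = d.get j → σ i < σ j) ∧
    (∀ i j, i < j → 1 < Nat.gcd (d.get i) (d.get j) → σ i < σ j)

/-! ### The refinement algorithm, with its arithmetic operations counted -/

/-- The number of gcd-computations and of integer divisions performed so far. -/
structure OpCount where
  gcds : ℕ
  divs : ℕ

/-- Computations that keep track of the number of arithmetic operations. -/
abbrev Counted (α : Type) : Type := StateM OpCount α

/-- One gcd-computation. -/
def gcdOp (a b : ℕ) : Counted ℕ :=
  fun s => (Nat.gcd a b, { s with gcds := s.gcds + 1 })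

/-- One integer division. -/
def divOp (a b : ℕ) : Counted ℕ :=
  fun s => (a / b, { s with divs := s.divs + 1 })

/-- The two matrices the algorithm works on: `ds` of size `l × (m + 1)` and `es` of size
`m × (l + 1)`. -/
structure RefineState (l m : ℕ) where
  ds : Fin l → Fin (m + 1) → ℕ
  es : Fin m → Fin (l + 1) → ℕ

/-- The assignment `A i j ← c` to one entry of a matrix. -/
def setEntry {r s : ℕ} (A : Fin r → Fin s → ℕ) (i : Fin r) (j : Fin s) (c : ℕ) :
    Fin r → Fin s → ℕ :=
  Function.update A i (Function.update (A i) j c)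

/-- The matrices at the start: all entries are `1`, except for the last columns, which hold
the entries of `d` and `e`, respectively. -/
def refineInit (d e : List ℕ) : RefineState d.length e.length where
  ds := fun i j => if j = Fin.last e.length then d.get i else 1
  es := fun j i => if i = Fin.last d.length then e.get j else 1

/-- The body of the inner loop, for the row index `i` and the column index `j`. -/
def refineStep {l m : ℕ} (i : Fin l) (S : RefineState l m) (j : Fin m) :
    Counted (RefineState l m) := do
  let c ← gcdOp (S.ds i (Fin.last m)) (S.es j (Fin.last l))
  let dQuot ← divOp (S.ds i (Fin.last m)) c
  let eQuot ← divOp (S.es j (Fin.last l)) c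
  pure
    { ds := setEntry (setEntry S.ds i j.castSucc c) i (Fin.last m) dQuot
      es := setEntry (setEntry S.es j i.castSucc c) j (Fin.last l) eQuot }

/-- The two nested loops: `i` runs through the rows, and `j` through the columns for each `i`. -/
def refineLoop {l m : ℕ} (S : RefineState l m) : Counted (RefineState l m) :=
  (List.finRange l).foldlM (fun S i => (List.finRange m).foldlM (refineStep i) S) S

/-- Remove the last column of a matrix, read it row by row as a sequence, and remove all `1`s. -/
def readOff {r s : ℕ} (A : Fin r → Fin (s + 1) → ℕ) : List ℕ :=
  ((List.finRange r).flatMap fun i =>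
    (List.finRange s).map fun j => A i j.castSucc).filter (fun x => x ≠ 1)

/-- The algorithm that refines `d` and `e`. -/
def refineAlgorithm (d e : List ℕ) : Counted (List ℕ × List ℕ) := do
  let S ← refineLoop (refineInit d e)
  pure (readOff S.ds, readOff S.es)

/-- The pair returned by the algorithm on input `d`, `e`. -/
def refineOutput (d e : List ℕ) : List ℕ × List ℕ :=
  (StateT.run (refineAlgorithm d e) ⟨0, 0⟩).1

/-- The numbers of operations used by the algorithm on input `d`, `e`. -/
def refineCost (d e : List ℕ) : OpCount :=
  (StateT.run (refineAlgorithm d e) ⟨0, 0⟩).2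

/-- The refinement `d // e` of `d` by `e`: the first component of the output on input `d`, `e`. -/
def refineBy (d e : List ℕ) : List ℕ := (refineOutput d e).1

/-! ### Compositions of monic original polynomials -/

section Polynomials

open Polynomial

/-- The set of monic original polynomials of degree `n`. -/
def monicOriginal (F : Type*) [Field F] (n : ℕ) : Set F[X] :=
  {f | f.Monic ∧ f.eval 0 = 0 ∧ f.natDegree = n}

/-- The composition `g 0 ∘ g 1 ∘ ... ∘ g (l - 1)`; it is `X` for `l = 0`. -/
noncomputable def compAll {F : Type*} [Field F] {l : ℕ} (g : Fin l → F[X]) : F[X] :=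
  (List.ofFn g).foldr (fun a b => a.comp b) X

/-- `g` is a sequence of monic original polynomials with degree sequence `d`. -/
def HasDegreeSequence {F : Type*} [Field F] (d : List ℕ) (g : Fin d.length → F[X]) : Prop :=
  ∀ i, g i ∈ monicOriginal F (d.get i)

/-- The monic original polynomials of degree `n` that have a decomposition into monic original
polynomials with degree sequence `d`. -/
def decomposables (F : Type*) [Field F] (n : ℕ) (d : List ℕ) : Set F[X] :=
  {f | f ∈ monicOriginal F n ∧ ∃ g : Fin d.length → F[X], HasDegreeSequence d g ∧ f = compAll g}

/-- The set of collisions for a set `D` of ordered factorizations of `n`. -/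
def collisions (F : Type*) [Field F] (n : ℕ) (D : Set (List ℕ)) : Set F[X] :=
  ⋂ d ∈ D, decomposables F n d

end Polynomials

/-! Let f be monic of degree n with n nonzero in F. Hensel's lemma gives a Laurent series z with
leading term t⁻¹ and f(z) = t⁻ⁿ (`exists_laurentEval_eq_single`), and p ↦ p(z) embeds F[x] into
F((t)). If f = g ∘ h with h monic of degree k, then h(z) lies in F((t^k)), because g(h(z)) does and
deg g is invertible. Conversely, if w is monic of degree k and w(z) lies in F((t^k)), then every p
with p(z) in F((t^k)) is a polynomial in w. So right components of degree k correspond to monic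
polynomials of degree k with values in F((t^k)).

It follows that the degrees of right components of f are closed under lcm, by a dimension count in
`exists_mem_monicOriginal_lcm`, and under gcd, by computing the gcd of g(Y) - g(x) and h(Y) - h(x)
in `exists_mem_monicOriginal_gcd`. Right components are also nested according to divisibility of
degrees. Hence f has a decomposition with degree sequence d exactly when each product of a final
segment of d is the degree of a right component (`mem_decomposables_iff_hasRightComponent`).

On the arithmetic side, let G(i,j) be the gcd of the products of the first i entries of d and the
first j entries of e. The algorithm writes G(i+1,j+1) G(i,j) / (G(i,j+1) G(i+1,j)) at (i,j). Entries
in opposite relative position are coprime, which makes the two readings associated. The product of a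
final segment of the refinement of d is either 1 or has the form gcd(d a', lcm(a', b')), with d a',
a' and b' products of final segments of d, d and e (`gcd_lcm_mul_gcd`), so it is the degree of a
right component. The same formula yields the splitting of a single component. -/

open Polynomial

/-! ### Laurent series with exponents in kℤ, leading terms, and the solution of f(z) = t⁻ⁿ. -/

section LaurentSeriesSupport

variable {F : Type*} [Field F]

/-- The Laurent series all of whose exponents are multiples of `k`. -/
def HasMultipleSupport (k : ℕ) (z : LaurentSeries F) : Prop :=
  ∀ m ∈ z.support, (k : ℤ) ∣ m

/-- The part of a Laurent series with exponents that are multiples of `k`. -/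
noncomputable def multiplePart (k : ℕ) (z : LaurentSeries F) : LaurentSeries F where
  coeff m := if (k : ℤ) ∣ m then z.coeff m else 0
  isPWO_support' := z.isPWO_support.mono (by
    intro m hm
    simp only [Function.mem_support, ne_eq, ite_eq_right_iff, not_forall] at hm
    exact hm.2)

theorem multiplePart_hasMultipleSupport (k : ℕ) (z : LaurentSeries F) :
    HasMultipleSupport k (multiplePart k z) := by
  intro m hm
  simp only [multiplePart, HahnSeries.mem_support, ne_eq, ite_eq_right_iff, not_forall] at hm
  exact hm.1

theorem not_dvd_of_mem_support_sub_multiplePart {k : ℕ} {z : LaurentSeries F} {m : ℤ}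
    (hm : m ∈ (z - multiplePart k z).support) : ¬ (k : ℤ) ∣ m := by
  intro h
  simp [multiplePart, h] at hm

theorem HasMultipleSupport.mul {k : ℕ} {y z : LaurentSeries F} (hy : HasMultipleSupport k y)
    (hz : HasMultipleSupport k z) : HasMultipleSupport k (y * z) := by
  intro m hm
  obtain ⟨i, hi, j, hj, rfl⟩ := Set.mem_add.1 (HahnSeries.support_mul_subset hm)
  exact dvd_add (hy i hi) (hz j hj)

theorem HasMultipleSupport.add {k : ℕ} {y z : LaurentSeries F} (hy : HasMultipleSupport k y)
    (hz : HasMultipleSupport k z) : HasMultipleSupport k (y + z) := by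
  intro m hm
  rcases HahnSeries.support_add_subset _ _ hm with h | h
  · exact hy m h
  · exact hz m h

theorem hasMultipleSupport_single {k : ℕ} {e : ℤ} (he : (k : ℤ) ∣ e) (c : F) :
    HasMultipleSupport k (HahnSeries.single e c : LaurentSeries F) := by
  intro m hm
  have := HahnSeries.support_single_subset hm
  rw [Set.mem_singleton_iff] at this
  rwa [this]

/-- A factor y with exponents in kℤ preserves residue classes of exponents modulo k. The product of
y with the part of z outside kℤ therefore has no exponent in kℤ, and must vanish. -/
theorem eq_zero_of_mul_sub_multiplePart {k : ℕ} {y z : LaurentSeries F}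
    (hy : HasMultipleSupport k y) (hy0 : y ≠ 0)
    (h : HasMultipleSupport k (y * (z - multiplePart k z))) : z = multiplePart k z := by
  have h0 : y * (z - multiplePart k z) = 0 := by
    by_contra hne
    obtain ⟨m, hm⟩ := HahnSeries.support_nonempty_iff.2 hne
    obtain ⟨i, hi, j, hj, rfl⟩ := Set.mem_add.1 (HahnSeries.support_mul_subset hm)
    exact not_dvd_of_mem_support_sub_multiplePart hj ((dvd_add_right (hy i hi)).1 (h _ hm))
  exact sub_eq_zero.1 ((mul_eq_zero.1 h0).resolve_left hy0)

/-- The subfield of Laurent series all of whose exponents are multiples of `k`. -/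
noncomputable def multipleSubfield (F : Type*) [Field F] (k : ℕ) : Subfield (LaurentSeries F) where
  carrier := {z | HasMultipleSupport k z}
  mul_mem' := HasMultipleSupport.mul
  add_mem' := HasMultipleSupport.add
  zero_mem' := by
    intro m hm
    simp at hm
  one_mem' := hasMultipleSupport_single (dvd_zero _) 1
  neg_mem' := by
    intro z hz m hm
    exact hz m (by simpa using hm)
  inv_mem' := by
    intro z hz
    by_cases h0 : z = 0
    · subst h0
      simpa using hz
    have hw := multiplePart_hasMultipleSupport k z⁻¹
    have : z⁻¹ = multiplePart k z⁻¹ := by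
      -- With w the part of z⁻¹ in kℤ, z (z⁻¹ - w) = 1 - z w has exponents in kℤ only.
      refine eq_zero_of_mul_sub_multiplePart hz h0 ?_
      rw [mul_sub, mul_inv_cancel₀ h0, sub_eq_add_neg]
      refine HasMultipleSupport.add (hasMultipleSupport_single (dvd_zero _) 1) ?_
      intro m hm
      exact hz.mul hw m (by simpa using hm)
    rw [this]
    exact hw

theorem multipleSubfield_mono {a g : ℕ} (h : g ∣ a) :
    multipleSubfield F a ≤ multipleSubfield F g := by
  intro z hz m hm
  exact (Int.natCast_dvd_natCast.2 h).trans (hz m hm)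

theorem mem_multipleSubfield_lcm {a b : ℕ} {z : LaurentSeries F} (ha : z ∈ multipleSubfield F a)
    (hb : z ∈ multipleSubfield F b) : z ∈ multipleSubfield F (Nat.lcm a b) := by
  intro m hm
  rw [Int.natCast_dvd]
  exact Nat.lcm_dvd (Int.natCast_dvd.1 (ha m hm)) (Int.natCast_dvd.1 (hb m hm))

theorem C_mem_multipleSubfield (k : ℕ) (c : F) :
    (HahnSeries.C c : LaurentSeries F) ∈ multipleSubfield F k :=
  hasMultipleSupport_single (dvd_zero _) c

/-- The value of a polynomial at a Laurent series. -/
noncomputable def laurentEval (z : LaurentSeries F) : F[X] →+* LaurentSeries F :=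
  eval₂RingHom HahnSeries.C z

theorem laurentEval_eq_sum_range {p : F[X]} {N : ℕ} (hp : p.natDegree < N)
    (z : LaurentSeries F) :
    laurentEval z p = ∑ i ∈ Finset.range N, HahnSeries.C (p.coeff i) * z ^ i :=
  eval₂_eq_sum_range' _ hp z

@[simp]
theorem laurentEval_C (z : LaurentSeries F) (c : F) : laurentEval z (C c) = HahnSeries.C c :=
  eval₂_C _ _

theorem laurentEval_comp (z : LaurentSeries F) (p q : F[X]) :
    laurentEval z (p.comp q) = laurentEval (laurentEval z q) p :=
  eval₂_comp _

theorem laurentEval_mem_multipleSubfield {k : ℕ} {z : LaurentSeries F}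
    (hz : z ∈ multipleSubfield F k) (p : F[X]) : laurentEval z p ∈ multipleSubfield F k := by
  rw [laurentEval_eq_sum_range (Nat.lt_succ_self _)]
  exact sum_mem fun i _ => mul_mem (C_mem_multipleSubfield k _) (pow_mem hz i)

/-- The Laurent series `z` has no exponents below `e`, and the coefficient `c` at `e`. -/
def HasLeadingTerm (e : ℤ) (c : F) (z : LaurentSeries F) : Prop :=
  ∃ w : PowerSeries F, PowerSeries.constantCoeff w = c ∧
    z = HahnSeries.single e 1 * (w : LaurentSeries F)

namespace HasLeadingTerm

theorem coeff_add {e : ℤ} {z : LaurentSeries F} {w : PowerSeries F}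
    (hz : z = HahnSeries.single e 1 * (w : LaurentSeries F)) (m : ℤ) :
    z.coeff (m + e) = (w : LaurentSeries F).coeff m := by
  rw [hz, HahnSeries.coeff_single_mul_add, one_mul]

theorem coeff_self {e : ℤ} {c : F} {z : LaurentSeries F} (h : HasLeadingTerm e c z) :
    z.coeff e = c := by
  obtain ⟨w, rfl, hz⟩ := h
  have := coeff_add hz 0
  rw [zero_add] at this
  rw [this, PowerSeries.coeff_coe]
  simp

theorem mem_support {e : ℤ} {c : F} {z : LaurentSeries F} (h : HasLeadingTerm e c z)
    (hc : c ≠ 0) : e ∈ z.support := by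
  rw [HahnSeries.mem_support, h.coeff_self]
  exact hc

theorem ne_zero {e : ℤ} {c : F} {z : LaurentSeries F} (h : HasLeadingTerm e c z)
    (hc : c ≠ 0) : z ≠ 0 := by
  rintro rfl
  simpa using h.mem_support hc

theorem coeff_of_lt {e : ℤ} {c : F} {z : LaurentSeries F} (h : HasLeadingTerm e c z) {m : ℤ}
    (hm : m < e) : z.coeff m = 0 := by
  obtain ⟨w, -, hz⟩ := h
  have := coeff_add hz (m - e)
  rw [sub_add_cancel] at this
  rw [this, PowerSeries.coeff_coe, if_pos (by omega)]

theorem of_coeff {e : ℤ} {z : LaurentSeries F} (h : ∀ m < e, z.coeff m = 0) :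
    HasLeadingTerm e (z.coeff e) z := by
  refine ⟨PowerSeries.mk fun k => z.coeff (e + k), by simp, ?_⟩
  ext m
  obtain ⟨k, rfl⟩ : ∃ k, m = k + e := ⟨m - e, by ring⟩
  rw [HahnSeries.coeff_single_mul_add, one_mul, PowerSeries.coeff_coe]
  split_ifs with hk
  · exact h _ (by omega)
  · rw [PowerSeries.coeff_mk]
    congr 1
    omega

theorem mul {e e' : ℤ} {c c' : F} {y z : LaurentSeries F} (hy : HasLeadingTerm e c y)
    (hz : HasLeadingTerm e' c' z) : HasLeadingTerm (e + e') (c * c') (y * z) := by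
  obtain ⟨v, rfl, rfl⟩ := hy
  obtain ⟨w, rfl, rfl⟩ := hz
  refine ⟨v * w, by simp, ?_⟩
  have : (HahnSeries.single (e + e') (1 : F) : LaurentSeries F) =
      HahnSeries.single e 1 * HahnSeries.single e' 1 := by simp
  rw [this, PowerSeries.coe_mul]
  ring

theorem add {e : ℤ} {c c' : F} {y z : LaurentSeries F} (hy : HasLeadingTerm e c y)
    (hz : HasLeadingTerm e c' z) : HasLeadingTerm e (c + c') (y + z) := by
  obtain ⟨v, rfl, rfl⟩ := hy
  obtain ⟨w, rfl, rfl⟩ := hz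
  exact ⟨v + w, by simp, by rw [PowerSeries.coe_add, mul_add]⟩

protected theorem zero (e : ℤ) : HasLeadingTerm e (0 : F) 0 :=
  ⟨0, by simp, by simp⟩

protected theorem one : HasLeadingTerm 0 (1 : F) 1 :=
  ⟨1, by simp, by simp⟩

theorem sum {ι : Type*} {e : ℤ} {c : ι → F} {z : ι → LaurentSeries F} (s : Finset ι)
    (h : ∀ i ∈ s, HasLeadingTerm e (c i) (z i)) :
    HasLeadingTerm e (∑ i ∈ s, c i) (∑ i ∈ s, z i) := by
  classical
  induction s using Finset.induction_on with
  | empty => simpa using HasLeadingTerm.zero e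
  | insert i s hi ih =>
    rw [Finset.sum_insert hi, Finset.sum_insert hi]
    exact (h i (Finset.mem_insert_self i s)).add
      (ih fun j hj => h j (Finset.mem_insert_of_mem hj))

theorem pow {e : ℤ} {z : LaurentSeries F} (h : HasLeadingTerm e 1 z) (i : ℕ) :
    HasLeadingTerm (i * e) 1 (z ^ i) := by
  induction i with
  | zero => simpa using HasLeadingTerm.one
  | succ i ih =>
    have := ih.mul h
    rw [one_mul] at this
    rw [pow_succ]
    convert this using 1
    push_cast
    ring

theorem const_mul {e : ℤ} {c : F} {z : LaurentSeries F} (h : HasLeadingTerm e c z) (b : F) :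
    HasLeadingTerm e (b * c) (HahnSeries.C b * z) := by
  obtain ⟨w, rfl, rfl⟩ := h
  refine ⟨PowerSeries.C b * w, by simp, ?_⟩
  rw [PowerSeries.coe_mul, PowerSeries.coe_C]
  ring

theorem of_lt {e e' : ℤ} {c : F} {z : LaurentSeries F} (h : HasLeadingTerm e c z) (he : e' < e) :
    HasLeadingTerm e' 0 z := by
  obtain ⟨w, rfl, rfl⟩ := h
  obtain ⟨k, hk⟩ := Int.eq_ofNat_of_zero_le (sub_nonneg.2 he.le)
  have hk0 : k ≠ 0 := by
    rintro rfl
    rw [Nat.cast_zero] at hk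
    omega
  refine ⟨PowerSeries.X ^ k * w, by simp [hk0], ?_⟩
  rw [PowerSeries.coe_mul, PowerSeries.coe_pow, ← mul_assoc]
  congr 1
  rw [show HahnSeries.ofPowerSeries ℤ F (PowerSeries.X : PowerSeries F) =
    HahnSeries.single 1 1 by simp, HahnSeries.single_pow, HahnSeries.single_mul_single]
  rw [one_pow, mul_one, nsmul_eq_mul, mul_one, ← hk, add_sub_cancel]

/-- The leading term of the value of a polynomial at a Laurent series with a pole. -/
theorem laurentEval {a : ℕ} (ha : 0 < a) {z : LaurentSeries F} (h : HasLeadingTerm (-a) 1 z)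
    {p : F[X]} {N : ℕ} (hp : p.natDegree ≤ N) :
    HasLeadingTerm (-(a * N : ℕ)) (p.coeff N) (_root_.laurentEval z p) := by
  rw [laurentEval_eq_sum_range (Nat.lt_succ_of_le hp)]
  have hs : p.coeff N = ∑ i ∈ Finset.range (N + 1), if i = N then p.coeff i else 0 := by
    rw [Finset.sum_ite_eq' (Finset.range (N + 1)) N]
    simp
  rw [hs]
  refine sum _ fun i hi => ?_
  have h1 := (h.pow i).const_mul (p.coeff i)
  by_cases hiN : i = N
  · subst hiN
    rw [if_pos rfl]
    convert h1 using 1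
    · push_cast; ring
    · rw [mul_one]
  · rw [if_neg hiN]
    refine h1.of_lt ?_
    have : i < N := by
      have := Finset.mem_range.1 hi
      omega
    have h2 : a * i < a * N := Nat.mul_lt_mul_of_pos_left this ha
    push_cast
    have h3 : (a : ℤ) * i < a * N := by exact_mod_cast h2
    linarith [mul_comm (a : ℤ) i]

end HasLeadingTerm

/-- The quotient q is the sum of p_i times the geometric sums of y^j z^(i-1-j). Each such product
has leading exponent -a(i-1), so only i = N + 1 reaches -aN, with N + 1 equal contributions. This is
the source of the tameness condition. -/
theorem exists_sub_eq_mul_of_hasLeadingTerm {a : ℕ} (ha : 0 < a) {y z : LaurentSeries F}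
    (hy : HasLeadingTerm (-a) 1 y) (hz : HasLeadingTerm (-a) 1 z) {p : F[X]} {N : ℕ}
    (hp : p.natDegree ≤ N + 1) :
    ∃ q, HasLeadingTerm (-(a * N : ℕ)) ((N + 1 : ℕ) * p.coeff (N + 1)) q ∧
      laurentEval y p - laurentEval z p = q * (y - z) := by
  refine ⟨∑ i ∈ Finset.range (N + 1 + 1),
    HahnSeries.C (p.coeff i) * ∑ j ∈ Finset.range i, y ^ j * z ^ (i - 1 - j), ?_, ?_⟩
  · have hs : ((N + 1 : ℕ) : F) * p.coeff (N + 1) = ∑ i ∈ Finset.range (N + 1 + 1),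
        p.coeff i * ∑ j ∈ Finset.range i, if i = N + 1 then 1 else 0 := by
      rw [Finset.sum_eq_single (N + 1)]
      · simp [mul_comm]
      · intro i _ hi
        simp [hi]
      · simp
    rw [hs]
    refine HasLeadingTerm.sum _ fun i hi => HasLeadingTerm.const_mul ?_ _
    refine HasLeadingTerm.sum _ fun j hj => ?_
    have hj' := Finset.mem_range.1 hj
    have hi' := Finset.mem_range.1 hi
    have h1 := (hy.pow j).mul (hz.pow (i - 1 - j))
    have he : (j : ℤ) * -(a : ℤ) + ((i - 1 - j : ℕ) : ℤ) * -(a : ℤ) = -(a * (i - 1) : ℤ) := by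
      rw [← add_mul, ← Nat.cast_add, show j + (i - 1 - j) = i - 1 by omega, Nat.cast_sub (by omega)]
      push_cast
      ring
    rw [he, one_mul] at h1
    by_cases hiN : i = N + 1
    · subst hiN
      rw [if_pos rfl]
      convert h1 using 1
      push_cast
      ring
    · rw [if_neg hiN]
      refine h1.of_lt ?_
      have h2 : (i : ℤ) - 1 < N := by omega
      have h3 : (a : ℤ) * (i - 1) < a * N := mul_lt_mul_of_pos_left h2 (by exact_mod_cast ha)
      push_cast
      linarith
  · rw [laurentEval_eq_sum_range (Nat.lt_succ_of_le hp),
      laurentEval_eq_sum_range (Nat.lt_succ_of_le hp),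
      ← Finset.sum_sub_distrib, Finset.sum_mul]
    refine Finset.sum_congr rfl fun i _ => ?_
    rw [mul_assoc, (Commute.all y z).geom_sum₂_mul, mul_sub]

/-- Let y be the part of z with exponents in aℤ. Then p(z) - p(y) = q (z - y) has exponents in aℤ,
and q starts at a multiple of a with nonzero coefficient. If z ≠ y, the leading exponent of z - y
would be a multiple of a, which is excluded. -/
theorem mem_multipleSubfield_of_laurentEval_mem {a : ℕ} (ha : 0 < a) {z : LaurentSeries F}
    (hz : HasLeadingTerm (-a) 1 z) {p : F[X]} {N : ℕ} (hN : p.natDegree ≤ N + 1)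
    (hp : ((N + 1 : ℕ) : F) * p.coeff (N + 1) ≠ 0)
    (h : laurentEval z p ∈ multipleSubfield F a) : z ∈ multipleSubfield F a := by
  set y := multiplePart a z with hydef
  have hyS : y ∈ multipleSubfield F a := multiplePart_hasMultipleSupport a z
  have hy : HasLeadingTerm (-a) 1 y := by
    have h1 : y.coeff (-a) = 1 := by
      rw [hydef]
      simp only [multiplePart, dvd_neg, dvd_refl, if_true]
      exact hz.coeff_self
    rw [← h1]
    refine HasLeadingTerm.of_coeff fun m hm => ?_
    rw [hydef]
    simp only [multiplePart]
    rw [hz.coeff_of_lt hm, ite_self]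
  obtain ⟨q, hq, hpq⟩ := exists_sub_eq_mul_of_hasLeadingTerm ha hz hy hN
  have hw := sub_mem h (laurentEval_mem_multipleSubfield hyS p)
  rw [hpq] at hw
  by_contra hzS
  have hne : z - y ≠ 0 := fun h0 => hzS (sub_eq_zero.1 h0 ▸ hyS)
  have hlead : HasLeadingTerm (z - y).order ((z - y).coeff (z - y).order) (z - y) :=
    HasLeadingTerm.of_coeff fun m hm => HahnSeries.coeff_eq_zero_of_lt_order hm
  have hc : (z - y).coeff (z - y).order ≠ 0 := fun h0 => hne (HahnSeries.coeff_order_eq_zero.1 h0)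
  have hdvd := hw _ ((hq.mul hlead).mem_support (mul_ne_zero hp hc))
  refine not_dvd_of_mem_support_sub_multiplePart (hlead.mem_support hc) ((dvd_add_right ?_).1 hdvd)
  rw [dvd_neg]
  push_cast
  exact dvd_mul_right _ _

theorem dvd_natDegree_of_laurentEval_mem {k : ℕ} {z : LaurentSeries F}
    (hz : HasLeadingTerm (-1) 1 z) {p : F[X]} (h : laurentEval z p ∈ multipleSubfield F k) :
    k ∣ p.natDegree := by
  by_cases hp : p = 0
  · simp [hp]
  have := HasLeadingTerm.laurentEval (a := 1) one_pos (by simpa using hz) (le_refl p.natDegree)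
  have h1 := h _ (this.mem_support (by simpa using hp))
  rw [dvd_neg, one_mul, Int.natCast_dvd_natCast] at h1
  exact h1

theorem laurentEval_injective {z : LaurentSeries F} (hz : HasLeadingTerm (-1) 1 z) :
    Function.Injective (laurentEval z) := by
  refine (injective_iff_map_eq_zero _).2 fun p hp => ?_
  by_contra h0
  have := HasLeadingTerm.laurentEval (a := 1) one_pos (by simpa using hz) (le_refl p.natDegree)
  exact this.ne_zero (by simpa using h0) hp

/-- Supplies Hensel's lemma for power series. Congruence modulo Xⁿ is equality of the coefficients
below n, so coefficient m of the limit can be read off from term m + 1. -/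
theorem isAdicComplete_span_X :
    IsAdicComplete (Ideal.span {(PowerSeries.X : PowerSeries F)}) (PowerSeries F) := by
  have key : ∀ (n : ℕ) (f g : PowerSeries F),
      f ≡ g [SMOD ((Ideal.span {(PowerSeries.X : PowerSeries F)}) ^ n • ⊤ :
        Submodule (PowerSeries F) (PowerSeries F))] ↔
      ∀ m < n, PowerSeries.coeff m f = PowerSeries.coeff m g := by
    intro n f g
    rw [SModEq.sub_mem, Ideal.smul_eq_mul, Ideal.mul_top, Ideal.span_singleton_pow,
      Ideal.mem_span_singleton, PowerSeries.X_pow_dvd_iff]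
    simp only [map_sub, sub_eq_zero]
  refine { haus' := fun f hf => ?_, prec' := fun f hf => ?_ }
  · ext m
    exact (key _ _ _).1 (hf (m + 1)) m (Nat.lt_succ_self m)
  · refine ⟨PowerSeries.mk fun m => PowerSeries.coeff m (f (m + 1)), fun n => ?_⟩
    rw [key]
    intro m hm
    rw [PowerSeries.coeff_mk]
    exact ((key _ _ _).1 (hf (Nat.succ_le_of_lt hm)) m (Nat.lt_succ_self m)).symm

/-- Put z = t⁻¹ w and multiply f(z) = t⁻ⁿ by tⁿ. The resulting polynomial equation for w reduces to
wⁿ = 1 modulo t, and its root 1 is simple because n is nonzero in F. -/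
theorem exists_laurentEval_eq_single {f : F[X]} (hf : f.Monic) (hn : (f.natDegree : F) ≠ 0) :
    ∃ z : LaurentSeries F, HasLeadingTerm (-1) 1 z ∧
      laurentEval z f = HahnSeries.single (-(f.natDegree : ℤ)) 1 := by
  have := isAdicComplete_span_X (F := F)
  have hH : HenselianRing (PowerSeries F) (Ideal.span {PowerSeries.X}) := inferInstance
  set n := f.natDegree with hndef
  have hn0 : 0 < n := Nat.pos_of_ne_zero fun h => hn (by simp [h])
  let R : (PowerSeries F)[X] := ∑ i ∈ Finset.range n,
    C (PowerSeries.C (f.coeff i) * PowerSeries.X ^ (n - i)) * X ^ i - 1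
  have hR : R ∈ degreeLT (PowerSeries F) n := by
    refine sub_mem (sum_mem fun i hi => mem_degreeLT.2 ?_) (mem_degreeLT.2 ?_)
    · exact (degree_C_mul_X_pow_le _ _).trans_lt (by exact_mod_cast Finset.mem_range.1 hi)
    · rw [degree_one]
      exact_mod_cast hn0
  have hmap : (X ^ n + R).map PowerSeries.constantCoeff = X ^ n - 1 := by
    simp only [R, Polynomial.map_add, Polynomial.map_sub, Polynomial.map_pow, map_X,
      Polynomial.map_sum, Polynomial.map_mul, map_C, map_mul, map_pow, Polynomial.map_one]
    rw [Finset.sum_eq_zero, zero_sub, sub_eq_add_neg]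
    intro i hi
    have : n - i ≠ 0 := Nat.sub_ne_zero_of_lt (Finset.mem_range.1 hi)
    simp [this]
  have heval : ∀ p : (PowerSeries F)[X],
      PowerSeries.constantCoeff (p.eval 1) = (p.map PowerSeries.constantCoeff).eval 1 := by
    intro p
    rw [eval_map, ← map_one (PowerSeries.constantCoeff (R := F)), eval₂_at_apply]
  have hX : ∀ p : PowerSeries F, p ∈ Ideal.span {PowerSeries.X} ↔
      PowerSeries.constantCoeff p = 0 := fun p => by
    rw [Ideal.mem_span_singleton, PowerSeries.X_dvd_iff]
  obtain ⟨w, hw, hw1⟩ := hH.is_henselian (X ^ n + R) (monic_X_pow_add (mem_degreeLT.1 hR)) 1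
    (by rw [hX, heval, hmap]; simp)
    (by
      refine IsUnit.map _ (PowerSeries.isUnit_iff_constantCoeff.2 ?_)
      rw [heval, ← derivative_map, hmap]
      simpa [derivative_X_pow] using hn)
  rw [hX, map_sub, map_one, sub_eq_zero] at hw1
  refine ⟨HahnSeries.single (-1) 1 * (w : LaurentSeries F), ⟨w, hw1, rfl⟩, ?_⟩
  have hw' : ∑ i ∈ Finset.range (n + 1),
      PowerSeries.C (f.coeff i) * PowerSeries.X ^ (n - i) * w ^ i = 1 := by
    rw [Finset.sum_range_succ, hndef, hf.coeff_natDegree, ← hndef]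
    rw [IsRoot.def] at hw
    simp only [R, eval_add, eval_pow, eval_X, eval_sub, eval_finsetSum, eval_mul, eval_C,
      eval_one] at hw
    simp only [map_one, Nat.sub_self, pow_zero, one_mul]
    linear_combination hw
  have hw2 := congrArg (HahnSeries.ofPowerSeries ℤ F) hw'
  rw [map_sum, map_one] at hw2
  rw [laurentEval_eq_sum_range (Nat.lt_succ_self _), ← hndef,
    ← mul_one (HahnSeries.single (-(n : ℤ)) (1 : F)), ← hw2, Finset.mul_sum]
  refine Finset.sum_congr rfl fun i hi => ?_
  have hin : i ≤ n := Nat.lt_succ_iff.1 (Finset.mem_range.1 hi)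
  simp only [map_mul, map_pow, PowerSeries.coe_C, PowerSeries.coe_X, mul_pow, HahnSeries.single_pow,
    one_pow]
  have : (HahnSeries.single (i • (-1 : ℤ)) (1 : F) : LaurentSeries F) =
      HahnSeries.single (-(n : ℤ)) 1 * HahnSeries.single ((n - i) • (1 : ℤ)) 1 := by
    rw [HahnSeries.single_mul_single, mul_one]
    congr 1
    simp only [nsmul_eq_mul]
    push_cast [hin]
    ring_nf
  rw [this]
  ring_nf

end LaurentSeriesSupport

/-! ### Polynomials with values in F((t^k)), and least common multiples of degrees. -/

section TameComponents

variable {F : Type*} [Field F]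

/-- The leading exponent of p(z) is -deg p, so k divides deg p. Subtracting a multiple of a power of
w lowers the degree and keeps the value in F((t^k)). -/
theorem exists_eq_comp_of_mem_multipleSubfield {z : LaurentSeries F}
    (hz : HasLeadingTerm (-1) 1 z) {k : ℕ} {w : F[X]} (hw : w.Monic)
    (hwk : w.natDegree = k) (hwS : laurentEval z w ∈ multipleSubfield F k) (p : F[X])
    (hp : laurentEval z p ∈ multipleSubfield F k) : ∃ u : F[X], p = u.comp w := by
  induction hd : p.natDegree using Nat.strong_induction_on generalizing p with
  | _ d ih =>
    by_cases hd0 : d = 0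
    · rw [hd0] at hd
      exact ⟨p, by rw [eq_C_of_natDegree_eq_zero hd, C_comp]⟩
    obtain ⟨i, hi⟩ := dvd_natDegree_of_laurentEval_mem hz hp
    have hp0 : p ≠ 0 := by
      rintro rfl
      exact hd0 (by simpa using hd.symm)
    have hwi : (w ^ i).natDegree = p.natDegree := by
      rw [hw.natDegree_pow, hwk, hi, mul_comm]
    have hq : (C p.leadingCoeff * w ^ i).natDegree = p.natDegree := by
      rw [natDegree_C_mul (leadingCoeff_ne_zero.2 hp0), hwi]
    have hlt : (p - C p.leadingCoeff * w ^ i).natDegree < d := by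
      by_cases h0 : p - C p.leadingCoeff * w ^ i = 0
      · rw [h0, natDegree_zero]
        exact Nat.pos_of_ne_zero hd0
      · rw [← hd]
        refine natDegree_lt_natDegree h0 (degree_sub_lt_left ?_ hp0 ?_)
        · rw [degree_eq_natDegree hp0, degree_eq_natDegree, hq]
          exact mul_ne_zero (C_ne_zero.2 (leadingCoeff_ne_zero.2 hp0)) (hw.pow i).ne_zero
        · rw [leadingCoeff_mul, leadingCoeff_C, (hw.pow i).leadingCoeff, mul_one]
    obtain ⟨u, hu⟩ := ih _ hlt (p - C p.leadingCoeff * w ^ i) (by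
      rw [map_sub, map_mul, map_pow, laurentEval_C]
      exact sub_mem hp (mul_mem (C_mem_multipleSubfield k _) (pow_mem hwS i))) rfl
    exact ⟨u + C p.leadingCoeff * X ^ i, by
      rw [add_comp, mul_comp, C_comp, pow_comp, X_comp, ← hu, sub_add_cancel]⟩

/-- Here g is evaluated at h(z), which has leading exponent -deg h, and the value t⁻ⁿ lies in
F((t^(deg h))). The degree of g is invertible since it divides n. -/
theorem laurentEval_mem_multipleSubfield_of_eq_comp {z : LaurentSeries F}
    (hz : HasLeadingTerm (-1) 1 z) {f g h : F[X]} (hn : (f.natDegree : F) ≠ 0)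
    (hfz : laurentEval z f = HahnSeries.single (-(f.natDegree : ℤ)) 1) (hh : h.Monic)
    (hfg : f = g.comp h) : laurentEval z h ∈ multipleSubfield F h.natDegree := by
  have hdeg : f.natDegree = g.natDegree * h.natDegree := by rw [hfg, natDegree_comp]
  have hgh : (g.natDegree : F) ≠ 0 ∧ (h.natDegree : F) ≠ 0 := by
    rw [hdeg, Nat.cast_mul] at hn
    exact ⟨left_ne_zero_of_mul hn, right_ne_zero_of_mul hn⟩
  have hh0 : 0 < h.natDegree := Nat.pos_of_ne_zero fun h => hgh.2 (by simp [h])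
  obtain ⟨N, hN⟩ : ∃ N, g.natDegree = N + 1 :=
    Nat.exists_eq_succ_of_ne_zero fun h => hgh.1 (by simp [h])
  have hg0 : g.coeff (N + 1) ≠ 0 := by
    rw [← hN, coeff_natDegree, leadingCoeff_ne_zero]
    rintro rfl
    simp at hN
  have hlead := HasLeadingTerm.laurentEval (a := 1) one_pos (by simpa using hz)
    (le_refl h.natDegree)
  rw [one_mul, coeff_natDegree, hh.leadingCoeff] at hlead
  refine mem_multipleSubfield_of_laurentEval_mem hh0 hlead (N := N) (p := g) hN.le
    (mul_ne_zero (hN ▸ hgh.1) hg0) ?_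
  rw [← laurentEval_comp, ← hfg, hfz]
  refine hasMultipleSupport_single ?_ 1
  rw [hdeg, dvd_neg, Nat.cast_mul]
  exact dvd_mul_left _ _

theorem exists_mem_monicOriginal_of_natDegree_eq {z : LaurentSeries F} {k : ℕ} (hk : 0 < k)
    {p : F[X]} (hp : laurentEval z p ∈ multipleSubfield F k) (hpk : p.natDegree = k) :
    ∃ w ∈ monicOriginal F k, laurentEval z w ∈ multipleSubfield F k := by
  have hdeg : (p - C (p.eval 0)).natDegree = k := by rw [natDegree_sub_C, hpk]
  have hne : p - C (p.eval 0) ≠ 0 := by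
    intro h
    rw [h, natDegree_zero] at hdeg
    omega
  have hlc := leadingCoeff_ne_zero.2 hne
  refine ⟨C (p - C (p.eval 0)).leadingCoeff⁻¹ * (p - C (p.eval 0)), ⟨?_, ?_, ?_⟩, ?_⟩
  · rw [Monic, leadingCoeff_mul, leadingCoeff_C, inv_mul_cancel₀ hlc]
  · simp
  · rw [natDegree_C_mul (inv_ne_zero hlc), hdeg]
  · rw [map_mul, map_sub, laurentEval_C, laurentEval_C]
    exact mul_mem (C_mem_multipleSubfield k _) (sub_mem hp (C_mem_multipleSubfield k _))

/-- The inequality is strict because lcm a b is a multiple of both a and b. -/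
theorem card_filter_dvd_or_dvd_lt {a b : ℕ} (ha : 0 < a) (hb : 0 < b) :
    ((Finset.Ioc 0 (Nat.lcm a b)).filter fun m => a ∣ m ∨ b ∣ m).card <
      Nat.lcm a b / a + Nat.lcm a b / b := by
  rw [Finset.filter_or]
  have h := Finset.card_union_add_card_inter ((Finset.Ioc 0 (Nat.lcm a b)).filter (a ∣ ·))
    ((Finset.Ioc 0 (Nat.lcm a b)).filter (b ∣ ·))
  rw [Nat.Ioc_filter_dvd_card_eq_div, Nat.Ioc_filter_dvd_card_eq_div] at h
  have h2 : 0 < (((Finset.Ioc 0 (Nat.lcm a b)).filter (a ∣ ·)) ∩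
      ((Finset.Ioc 0 (Nat.lcm a b)).filter (b ∣ ·))).card := by
    refine Finset.card_pos.2 ⟨Nat.lcm a b, ?_⟩
    simp [Nat.lcm_pos ha hb, Nat.dvd_lcm_left, Nat.dvd_lcm_right]
  exact (Nat.lt_add_of_pos_right h2).trans_eq h

/-- The linear combination of the positive powers of `h` with the coefficients `c`. -/
noncomputable def powerCombination (h : F[X]) (N : ℕ) : (Fin N → F) →ₗ[F] F[X] where
  toFun c := ∑ i, C (c i) * h ^ (i.1 + 1)
  map_add' c c' := by simp [add_mul, Finset.sum_add_distrib]
  map_smul' r c := by simp [Finset.mul_sum, mul_assoc, smul_eq_C_mul]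

theorem powerCombination_eq_comp (h : F[X]) {N : ℕ} (c : Fin N → F) :
    powerCombination h N c = (powerCombination X N c).comp h := by
  simp [powerCombination, Polynomial.sum_comp]

theorem coeff_powerCombination_X {N : ℕ} (c : Fin N → F) (i : Fin N) :
    (powerCombination X N c).coeff (i.1 + 1) = c i := by
  simp only [powerCombination, LinearMap.coe_mk, AddHom.coe_mk, finsetSum_coeff, coeff_C_mul,
    coeff_X_pow]
  rw [Finset.sum_eq_single i]
  · simp
  · intro j _ hj
    have : i.1 ≠ j.1 := fun h => hj (Fin.ext h.symm)
    simp [this]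
  · simp

theorem eval_zero_powerCombination {h : F[X]} (hh : h.eval 0 = 0) {N : ℕ} (c : Fin N → F) :
    (powerCombination h N c).eval 0 = 0 := by
  simp [powerCombination, eval_finsetSum, hh]

theorem natDegree_powerCombination_le (h : F[X]) {N : ℕ} (c : Fin N → F) :
    (powerCombination h N c).natDegree ≤ h.natDegree * N := by
  change (∑ i, C (c i) * h ^ (i.1 + 1)).natDegree ≤ _
  refine Polynomial.natDegree_sum_le_of_forall_le Finset.univ _ fun i _ => ?_
  refine (natDegree_C_mul_le _ _).trans (natDegree_pow_le.trans ?_)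
  rw [mul_comm]
  exact Nat.mul_le_mul_left _ i.2

theorem powerCombination_eq_zero {h : F[X]} (hh : 0 < h.natDegree) {N : ℕ} {c : Fin N → F}
    (hc : powerCombination h N c = 0) : c = 0 := by
  rw [powerCombination_eq_comp] at hc
  have h1 : powerCombination X N c = 0 := by
    rcases comp_eq_zero_iff.1 hc with h1 | ⟨-, h1⟩
    · exact h1
    · rw [h1, natDegree_C] at hh
      exact absurd hh (lt_irrefl 0)
  ext i
  rw [← coeff_powerCombination_X c i, h1, coeff_zero, Pi.zero_apply]

/-- If there are monic original polynomials of degrees `a` and `b` with exponents in `aℤ` and `bℤ`,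
then there is one of degree `lcm a b` with exponents in `(lcm a b)ℤ`. -/
theorem exists_mem_monicOriginal_lcm {z : LaurentSeries F} (hz : HasLeadingTerm (-1) 1 z)
    {a b : ℕ} (ha : 0 < a) (hb : 0 < b) {g h : F[X]} (hg : g ∈ monicOriginal F a)
    (hh : h ∈ monicOriginal F b) (hgS : laurentEval z g ∈ multipleSubfield F a)
    (hhS : laurentEval z h ∈ multipleSubfield F b) :
    ∃ w ∈ monicOriginal F (Nat.lcm a b),
      laurentEval z w ∈ multipleSubfield F (Nat.lcm a b) := by
  set l := Nat.lcm a b with hl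
  have hla : a * (l / a) = l := Nat.mul_div_cancel' (Nat.dvd_lcm_left a b)
  have hlb : b * (l / b) = l := Nat.mul_div_cancel' (Nat.dvd_lcm_right a b)
  have hl0 : 0 < l := Nat.lcm_pos ha hb
  let D := (Finset.Ioc 0 l).filter fun m => a ∣ m ∨ b ∣ m
  let S : ((Fin (l / a) → F) × (Fin (l / b) → F)) →ₗ[F] F[X] :=
    (powerCombination g _).coprod (powerCombination h _)
  let T : ((Fin (l / a) → F) × (Fin (l / b) → F)) →ₗ[F] (D → F) :=
    (LinearMap.pi fun m : D => lcoeff F m.1).comp S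
  -- There are l/a + l/b unknown coefficients, and fewer linear conditions: u + v shall have no
  -- coefficient at a positive multiple of a or of b up to l.
  have hker : LinearMap.ker T ≠ ⊥ := by
    refine LinearMap.ker_ne_bot_of_finrank_lt ?_
    simpa using card_filter_dvd_or_dvd_lt ha hb
  obtain ⟨⟨c, d⟩, hcd, hne⟩ := Submodule.exists_mem_ne_zero_of_ne_bot hker
  set u := powerCombination g _ c with hu
  set v := powerCombination h _ d with hv
  have hcoeff : ∀ m ∈ D, (u + v).coeff m = 0 := fun m hm =>
    congrFun (LinearMap.mem_ker.1 hcd) ⟨m, hm⟩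
  have huS : laurentEval z u ∈ multipleSubfield F a := by
    rw [hu, powerCombination_eq_comp, laurentEval_comp]
    exact laurentEval_mem_multipleSubfield hgS _
  have hvS : laurentEval z v ∈ multipleSubfield F b := by
    rw [hv, powerCombination_eq_comp, laurentEval_comp]
    exact laurentEval_mem_multipleSubfield hhS _
  have hudeg : u.natDegree ≤ l := by
    have := natDegree_powerCombination_le g c
    rwa [hg.2.2, hla] at this
  have hvdeg : v.natDegree ≤ l := by
    have := natDegree_powerCombination_le h d
    rwa [hh.2.2, hlb] at this
  have hu0 : u.eval 0 = 0 := eval_zero_powerCombination hg.2.1 c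
  have hv0 : v.eval 0 = 0 := eval_zero_powerCombination hh.2.1 d
  -- The leading exponent of (u + v)(z) occurs in u(z) or in v(z), so deg(u + v) is a multiple of a
  -- or b. The coefficient there was forced to vanish.
  have huv : u + v = 0 := by
    by_contra h0
    have hlead := HasLeadingTerm.laurentEval (a := 1) one_pos (by simpa using hz)
      (le_refl (u + v).natDegree)
    have hmem := hlead.mem_support (by simpa using h0)
    rw [map_add] at hmem
    have hdvd : a ∣ (u + v).natDegree ∨ b ∣ (u + v).natDegree := by
      refine (HahnSeries.support_add_subset _ _ hmem).imp (fun h1 => ?_) fun h1 => ?_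
      · have := huS _ h1
        rwa [dvd_neg, one_mul, Int.natCast_dvd_natCast] at this
      · have := hvS _ h1
        rwa [dvd_neg, one_mul, Int.natCast_dvd_natCast] at this
    have hpos : 0 < (u + v).natDegree := by
      refine Nat.pos_of_ne_zero fun h1 => h0 ?_
      rw [eq_C_of_natDegree_eq_zero h1, coeff_zero_eq_eval_zero, eval_add, hu0, hv0, add_zero, C_0]
    refine h0 (leadingCoeff_eq_zero.1 (hcoeff _ ?_))
    exact Finset.mem_filter.2 ⟨Finset.mem_Ioc.2 ⟨hpos,
      (natDegree_add_le _ _).trans (max_le hudeg hvdeg)⟩, hdvd⟩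
  have hune : u ≠ 0 := by
    intro h0
    refine hne (Prod.ext (powerCombination_eq_zero (hg.2.2.symm ▸ ha) h0)
      (powerCombination_eq_zero (hh.2.2.symm ▸ hb) ?_))
    rw [h0, zero_add] at huv
    exact huv
  have huS' : laurentEval z u ∈ multipleSubfield F b := by
    rw [eq_neg_of_add_eq_zero_left huv, map_neg]
    exact neg_mem hvS
  have huSl := mem_multipleSubfield_lcm huS huS'
  have hpos : 0 < u.natDegree := by
    refine Nat.pos_of_ne_zero fun h1 => hune ?_
    rw [eq_C_of_natDegree_eq_zero h1, coeff_zero_eq_eval_zero, hu0, C_0]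
  -- Since u = -v has its value in F((t^a)) and in F((t^b)), its degree is a positive multiple of l,
  -- and it is at most l.
  exact exists_mem_monicOriginal_of_natDegree_eq hl0 huSl
    (le_antisymm hudeg (Nat.le_of_dvd hpos (dvd_natDegree_of_laurentEval_mem hz huSl)))

end TameComponents

/-! ### Greatest common divisors of degrees, through common divisors of g(Y) - g(x) and h(Y) - h(x).
-/

section GcdComponents

variable {F : Type*} [Field F]

/-- The polynomial `h(Y) - h(x)` in `Y` with coefficients in `F[x]`. -/
noncomputable def differencePolynomial (h : F[X]) : F[X][X] :=
  h.map C - C h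

/-- The substitution `Y ↦ Y x`, written with `x` as the outer variable. -/
noncomputable def substMulX (F : Type*) [Field F] : F[X][X] →+* F[X][X] :=
  eval₂RingHom (mapRingHom C) (C X * X)

/-- After the substitution the outer degree is the total degree in Y and x, and coefficient m is the
dehomogenized form of total degree m. -/
theorem coeff_coeff_substMulX (S : F[X][X]) (m i : ℕ) :
    ((substMulX F S).coeff m).coeff i = if i ≤ m then (S.coeff i).coeff (m - i) else 0 := by
  induction S using Polynomial.induction_on' with
  | add p q hp hq =>
    rw [map_add, coeff_add, coeff_add, hp, hq]
    split_ifs <;> simp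
  | monomial j p =>
    have h : substMulX F (monomial j p) = C (X ^ j) * (p.map C * X ^ j) := by
      simp only [substMulX, coe_eval₂RingHom, eval₂_monomial, coe_mapRingHom, mul_pow, C_pow]
      ring
    rw [h, coeff_C_mul, coeff_mul_X_pow', coeff_monomial]
    rcases eq_or_ne j i with rfl | hji
    · rw [if_pos rfl]
      split_ifs with h1
      · rw [coeff_map, coeff_X_pow_mul', if_pos le_rfl, Nat.sub_self, coeff_C_zero]
      · simp
    · rw [if_neg hji, coeff_zero, ite_self]
      split_ifs with h1
      · rw [coeff_map, mul_comm, coeff_C_mul_X_pow, if_neg hji.symm]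
      · simp

theorem monic_differencePolynomial {h : F[X]} (hh : h.Monic) (h0 : 0 < h.natDegree) :
    (differencePolynomial h).Monic ∧ (differencePolynomial h).natDegree = h.natDegree := by
  have hm : (h.map (C : F →+* F[X])).Monic := hh.map C
  have hd : (h.map (C : F →+* F[X])).natDegree = h.natDegree :=
    natDegree_map_eq_of_injective C_injective h
  refine ⟨hm.sub_of_left ?_, ?_⟩
  · refine degree_C_le.trans_lt ?_
    rw [← natDegree_pos_iff_degree_pos, hd]
    exact h0
  · rw [differencePolynomial, natDegree_sub_C, hd]

theorem coeff_differencePolynomial (h : F[X]) (i : ℕ) :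
    (differencePolynomial h).coeff i = C (h.coeff i) - if i = 0 then h else 0 := by
  rw [differencePolynomial, coeff_sub, coeff_map, coeff_C]

theorem coeff_substMulX_differencePolynomial {h : F[X]} (hh : h.Monic) (h0 : 0 < h.natDegree) :
    (substMulX F (differencePolynomial h)).coeff h.natDegree = X ^ h.natDegree - 1 := by
  ext i
  rw [coeff_coeff_substMulX, coeff_differencePolynomial, coeff_sub, coeff_sub (X ^ _),
    coeff_X_pow, coeff_one]
  rcases Nat.eq_zero_or_pos i with rfl | hi
  · simp [hh.coeff_natDegree, coeff_C_of_ne_zero h0.ne', h0.ne]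
  · rw [if_neg hi.ne', coeff_zero, sub_zero, if_neg hi.ne', sub_zero, coeff_C]
    rcases lt_trichotomy i h.natDegree with hlt | heq | hgt
    · rw [if_pos hlt.le, if_neg (by omega), if_neg hlt.ne]
    · subst heq
      simp [hh.coeff_natDegree]
    · rw [if_neg (by omega), if_neg hgt.ne']

theorem natDegree_substMulX_differencePolynomial_le (h : F[X]) :
    (substMulX F (differencePolynomial h)).natDegree ≤ h.natDegree := by
  rw [natDegree_le_iff_coeff_eq_zero]
  intro m hm
  ext i
  rw [coeff_coeff_substMulX, coeff_differencePolynomial, coeff_zero, coeff_sub, coeff_C]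
  rcases Nat.eq_zero_or_pos i with rfl | hi
  · simp [(show m ≠ 0 by omega), coeff_eq_zero_of_natDegree_lt hm]
  · rw [if_neg hi.ne', coeff_zero, sub_zero]
    split_ifs with h1 h2
    · exact coeff_eq_zero_of_natDegree_lt (by omega)
    · rfl
    · rfl

theorem le_natDegree_substMulX {S : F[X][X]} (hS : S.Monic) :
    S.natDegree ≤ (substMulX F S).natDegree := by
  refine le_natDegree_of_ne_zero fun h => ?_
  have := coeff_coeff_substMulX S S.natDegree S.natDegree
  rw [h, if_pos le_rfl, hS.coeff_natDegree] at this
  simp at this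

/-- The top form of a monic divisor of `h(Y) - h(x)`. -/
theorem natDegree_substMulX_of_dvd {h : F[X]} (hh : h.Monic) (h0 : 0 < h.natDegree)
    {S : F[X][X]} (hS : S.Monic) (hdvd : S ∣ differencePolynomial h) :
    (substMulX F S).natDegree = S.natDegree ∧
      (substMulX F S).coeff S.natDegree ∣ X ^ h.natDegree - 1 := by
  obtain ⟨S', hS'⟩ := hdvd
  obtain ⟨hm, hd⟩ := monic_differencePolynomial hh h0
  have hmS' : S'.Monic := hS.of_mul_monic_left (hS' ▸ hm)
  have hsum : S.natDegree + S'.natDegree = h.natDegree := by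
    rw [← hd, hS', hS.natDegree_mul hmS']
  have hne : ∀ {T : F[X][X]}, T.Monic → substMulX F T ≠ 0 := by
    intro T hT hzero
    have := coeff_coeff_substMulX T T.natDegree T.natDegree
    rw [hzero, if_pos le_rfl, hT.coeff_natDegree] at this
    simp at this
  have hprod : substMulX F (differencePolynomial h) = substMulX F S * substMulX F S' := by
    rw [hS', map_mul]
  have hle := natDegree_substMulX_differencePolynomial_le h
  -- Total degrees add up to at most deg h. Each is at least the Y-degree of its monic factor, and
  -- the Y-degrees already add up to deg h, so equality holds in both factors.
  rw [hprod, natDegree_mul (hne hS) (hne hmS')] at hle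
  have h1 := le_natDegree_substMulX hS
  have h2 := le_natDegree_substMulX hmS'
  have h3 : (substMulX F S).natDegree = S.natDegree := by omega
  have h4 : (substMulX F S').natDegree = S'.natDegree := by omega
  refine ⟨h3, (substMulX F S').coeff S'.natDegree, ?_⟩
  rw [← coeff_substMulX_differencePolynomial hh h0, hprod, ← hsum]
  nth_rewrite 1 [← h3, ← h4]
  rw [coeff_mul_degree_add_degree, leadingCoeff, leadingCoeff, h3, h4]

/-- P divides Xⁿ - 1 exactly when the order of X in F[X]/(P) divides n. -/
theorem dvd_X_pow_gcd_sub_one {P : F[X]} {a b : ℕ} (ha : P ∣ X ^ a - 1) (hb : P ∣ X ^ b - 1) :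
    P ∣ X ^ Nat.gcd a b - 1 := by
  have key : ∀ n : ℕ, P ∣ X ^ n - 1 ↔ orderOf (AdjoinRoot.mk P X) ∣ n := by
    intro n
    rw [orderOf_dvd_iff_pow_eq_one, ← AdjoinRoot.mk_eq_zero, map_sub, map_pow, map_one, sub_eq_zero]
  rw [key] at *
  exact Nat.dvd_gcd ha hb

/-- Let the monic polynomial `S(Y)` over `F[x]` divide `g(Y) - g(x)` and `h(Y) - h(x)`, and vanish at
`Y = x`. If the degrees of its coefficients are multiples of `c = gcd (deg g) (deg h)`, then its
constant coefficient has degree `c`. -/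
theorem natDegree_coeff_zero_of_dvd_differencePolynomial {g h : F[X]} (hg : g.Monic)
    (hg0 : 0 < g.natDegree) (hh : h.Monic) (hh0 : 0 < h.natDegree) {S : F[X][X]} (hS : S.Monic)
    (hSg : S ∣ differencePolynomial g) (hSh : S ∣ differencePolynomial h) (hSX : S.eval X = 0)
    (hdeg : ∀ i, Nat.gcd g.natDegree h.natDegree ∣ (S.coeff i).natDegree) :
    (S.coeff 0).natDegree = Nat.gcd g.natDegree h.natDegree := by
  set c := Nat.gcd g.natDegree h.natDegree with hc
  have hc0 : 0 < c := Nat.gcd_pos_of_pos_left _ hg0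
  obtain ⟨hd, hdvdg⟩ := natDegree_substMulX_of_dvd hg hg0 hS hSg
  obtain ⟨-, hdvdh⟩ := natDegree_substMulX_of_dvd hh hh0 hS hSh
  have hPdvd := dvd_X_pow_gcd_sub_one hdvdg hdvdh
  rw [← hc] at hPdvd
  -- The top form of S divides X^c - 1 and has degree at least deg S.
  have hle : S.natDegree ≤ c := by
    have h1 : S.natDegree ≤ ((substMulX F S).coeff S.natDegree).natDegree := by
      refine le_natDegree_of_ne_zero ?_
      rw [coeff_coeff_substMulX, if_pos le_rfl, hS.coeff_natDegree]
      simp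
    refine h1.trans ((natDegree_le_of_dvd hPdvd ?_).trans (natDegree_X_pow_sub_C (r := (1 : F))).le)
    exact (monic_X_pow_sub_C (1 : F) hc0.ne').ne_zero
  have hcoeff : ∀ i ≤ S.natDegree, (S.coeff i).natDegree ≤ S.natDegree - i := by
    intro i hi
    rw [natDegree_le_iff_coeff_eq_zero]
    intro j hj
    have := coeff_coeff_substMulX S (i + j) i
    rw [if_pos (Nat.le_add_right i j), Nat.add_sub_cancel_left,
      coeff_eq_zero_of_natDegree_lt (by omega : _ < i + j), coeff_zero] at this
    exact this.symm
  -- These degrees are multiples of c and at most deg S - i < c.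
  have hconst : ∀ i, 0 < i → (S.coeff i).natDegree = 0 := by
    intro i hi
    by_cases hiS : i ≤ S.natDegree
    · refine Nat.eq_zero_of_dvd_of_lt (hdeg i) ?_
      have := hcoeff i hiS
      omega
    · rw [coeff_eq_zero_of_natDegree_lt (by omega), natDegree_zero]
  -- Otherwise all coefficients of S are constants. Then S has coefficients in F and vanishes at the
  -- indeterminate x, so S = 0.
  by_contra hne
  have h0 : (S.coeff 0).natDegree = 0 := by
    refine Nat.eq_zero_of_dvd_of_lt (hdeg 0) (lt_of_le_of_ne ?_ hne)
    have := hcoeff 0 (Nat.zero_le _)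
    omega
  have hall : ∀ i, S.coeff i = C ((S.coeff i).coeff 0) := fun i => by
    refine eq_C_of_natDegree_eq_zero ?_
    rcases Nat.eq_zero_or_pos i with rfl | hi
    exacts [h0, hconst i hi]
  obtain ⟨T, hT⟩ : ∃ T : F[X], T.map C = S := by
    rw [← mem_lifts, lifts_iff_coeff_lifts]
    exact fun i => ⟨_, (hall i).symm⟩
  rw [← hT, eval_map, eval₂_C_X] at hSX
  rw [← hT, hSX, Polynomial.map_zero] at hS
  exact hS.ne_zero rfl

theorem exists_fractionRing_lift {A L : Type*} [CommRing A] [IsDomain A] [Field L] {φ : A →+* L}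
    (hφ : Function.Injective φ) :
    ∃ ι : FractionRing A →+* L, ι.comp (algebraMap A (FractionRing A)) = φ :=
  ⟨IsFractionRing.lift hφ, RingHom.ext (IsFractionRing.lift_algebraMap hφ)⟩

/-- If there are monic original polynomials of degrees `a` and `b` with exponents in `aℤ` and `bℤ`,
then there is one of degree `gcd a b` with exponents in `(gcd a b)ℤ`. -/
theorem exists_mem_monicOriginal_gcd {z : LaurentSeries F} (hz : HasLeadingTerm (-1) 1 z)
    {a b : ℕ} (ha : 0 < a) (hb : 0 < b) {g h : F[X]} (hg : g ∈ monicOriginal F a)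
    (hh : h ∈ monicOriginal F b) (hgS : laurentEval z g ∈ multipleSubfield F a)
    (hhS : laurentEval z h ∈ multipleSubfield F b) :
    ∃ w ∈ monicOriginal F (Nat.gcd a b),
      laurentEval z w ∈ multipleSubfield F (Nat.gcd a b) := by
  classical
  set c := Nat.gcd a b with hc
  let K := FractionRing F[X]
  have hinj := laurentEval_injective hz
  obtain ⟨ι, hι⟩ : ∃ ι : K →+* LaurentSeries F, ι.comp (algebraMap F[X] K) = laurentEval z :=
    exists_fractionRing_lift hinj
  have hlift : ∀ p : F[X], laurentEval z p ∈ multipleSubfield F c →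
      ∃ q : (multipleSubfield F c)[X],
        q.map (multipleSubfield F c).subtype = (differencePolynomial p).map (laurentEval z) := by
    intro p hp
    rw [← mem_lifts, lifts_iff_coeff_lifts]
    intro i
    rw [coeff_map, coeff_differencePolynomial, map_sub, laurentEval_C]
    have hmem : (HahnSeries.C (p.coeff i) : LaurentSeries F) -
        laurentEval z (if i = 0 then p else 0) ∈ multipleSubfield F c := by
      refine sub_mem (C_mem_multipleSubfield c _) ?_
      split_ifs
      · exact hp
      · rw [map_zero]
        exact zero_mem _
    exact ⟨⟨_, hmem⟩, rfl⟩
  obtain ⟨hgm, hgd⟩ := monic_differencePolynomial hg.1 (hg.2.2.symm ▸ ha)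
  obtain ⟨hhm, hhd⟩ := monic_differencePolynomial hh.1 (hh.2.2.symm ▸ hb)
  have hgc := multipleSubfield_mono (F := F) (Nat.gcd_dvd_left a b) hgS
  have hhc := multipleSubfield_mono (F := F) (Nat.gcd_dvd_right a b) hhS
  obtain ⟨p, hp⟩ := hlift g hgc
  obtain ⟨q, hq⟩ := hlift h hhc
  set G : K[X] := EuclideanDomain.gcd ((differencePolynomial g).map (algebraMap F[X] K))
    ((differencePolynomial h).map (algebraMap F[X] K)) with hG
  -- A gcd of polynomials does not depend on the field: the one over F(x) agrees in F((t)) with the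
  -- one over F((t^c)).
  have hGmap : G.map ι = (EuclideanDomain.gcd p q).map (multipleSubfield F c).subtype := by
    rw [hG, ← gcd_map, ← gcd_map, hp, hq, Polynomial.map_map, Polynomial.map_map, hι]
  have hGg : G ∣ (differencePolynomial g).map (algebraMap F[X] K) := EuclideanDomain.gcd_dvd_left _ _
  have hGh : G ∣ (differencePolynomial h).map (algebraMap F[X] K) := EuclideanDomain.gcd_dvd_right _ _
  have hG0 : G ≠ 0 := ne_zero_of_dvd_ne_zero (hgm.map _).ne_zero hGg
  have hlc : G.leadingCoeff ≠ 0 := leadingCoeff_ne_zero.2 hG0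
  -- Gauss's lemma: the monic multiple of G has coefficients in F[x].
  obtain ⟨S, hS⟩ := IsIntegrallyClosed.eq_map_mul_C_of_dvd K hgm hGg
  have hSeq : S.map (algebraMap F[X] K) = G * C G.leadingCoeff⁻¹ := by
    nth_rewrite 1 [← hS]
    rw [mul_assoc, ← C_mul, mul_inv_cancel₀ hlc, C_1, mul_one]
  have hSm : S.Monic := by
    refine monic_of_injective (IsFractionRing.injective F[X] K) ?_
    rw [hSeq]
    exact monic_mul_leadingCoeff_inv hG0
  have hSdvd : ∀ r : F[X][X], G ∣ r.map (algebraMap F[X] K) → S ∣ r := by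
    intro r hr
    refine (map_dvd_map _ (IsFractionRing.injective F[X] K) hSm).1 ?_
    exact (Dvd.intro _ hS).trans hr
  have hSz : ∀ i, laurentEval z (S.coeff i) ∈ multipleSubfield F c := by
    intro i
    rw [← hι, RingHom.comp_apply, ← coeff_map, hSeq, coeff_mul_C, map_mul, map_inv₀]
    have hmem : ∀ j, ι (G.coeff j) ∈ multipleSubfield F c := by
      intro j
      rw [← coeff_map, hGmap, coeff_map]
      exact Subtype.property _
    exact mul_mem (hmem i) (inv_mem (hmem _))
  have hroot : ∀ r : F[X], (differencePolynomial r).eval X = 0 := by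
    intro r
    rw [differencePolynomial, eval_sub, eval_map, eval₂_C_X, eval_C, sub_self]
  have hSX : S.eval X = 0 := by
    apply IsFractionRing.injective F[X] K
    have hG1 : G.eval (algebraMap F[X] K X) = 0 := by
      refine eval_gcd_eq_zero ?_ ?_ <;> rw [eval_map, eval₂_at_apply, hroot, map_zero]
    rw [map_zero, ← eval₂_at_apply, ← eval_map, hSeq, eval_mul, hG1, zero_mul]
  have hdeg := natDegree_coeff_zero_of_dvd_differencePolynomial hg.1 (hg.2.2.symm ▸ ha) hh.1
    (hh.2.2.symm ▸ hb) hSm (hSdvd _ hGg) (hSdvd _ hGh) hSX (fun i => by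
      rw [hg.2.2, hh.2.2]
      exact dvd_natDegree_of_laurentEval_mem hz (hSz i))
  rw [hg.2.2, hh.2.2] at hdeg
  exact exists_mem_monicOriginal_of_natDegree_eq (Nat.gcd_pos_of_pos_left _ ha) (hSz 0) hdeg

end GcdComponents

/-! ### Right components and decompositions in the tame case. -/

section Decompositions

variable {F : Type*} [Field F]

theorem comp_mem_monicOriginal {a b : ℕ} (hb : 0 < b) {g h : F[X]} (hg : g ∈ monicOriginal F a)
    (hh : h ∈ monicOriginal F b) : g.comp h ∈ monicOriginal F (a * b) := by
  refine ⟨hg.1.comp hh.1 (hh.2.2.trans_ne hb.ne'), ?_, ?_⟩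
  · rw [eval_comp, hh.2.1, hg.2.1]
  · rw [natDegree_comp, hg.2.2, hh.2.2]

theorem X_mem_monicOriginal : (X : F[X]) ∈ monicOriginal F 1 :=
  ⟨monic_X, eval_X, natDegree_X⟩

theorem eq_X_of_mem_monicOriginal_one {f : F[X]} (hf : f ∈ monicOriginal F 1) : f = X := by
  have h := hf.1.eq_X_add_C hf.2.2
  have h0 := hf.2.1
  rw [h, eval_add, eval_X, eval_C, zero_add] at h0
  rw [h, h0, C_0, add_zero]

theorem comp_left_injective {r : F[X]} (hr : 0 < r.natDegree) {u v : F[X]}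
    (h : u.comp r = v.comp r) : u = v := by
  have h0 : (u - v).comp r = 0 := by rw [sub_comp, h, sub_self]
  rcases comp_eq_zero_iff.1 h0 with h1 | ⟨-, h1⟩
  · exact sub_eq_zero.1 h1
  · rw [h1, natDegree_C] at hr
    exact absurd hr (lt_irrefl 0)

theorem left_mem_monicOriginal {a b : ℕ} (hb : 0 < b) {f g h : F[X]}
    (hf : f ∈ monicOriginal F (a * b)) (hh : h ∈ monicOriginal F b) (hfg : f = g.comp h) :
    g ∈ monicOriginal F a := by
  refine ⟨?_, ?_, ?_⟩
  · have := hf.1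
    rw [hfg, Monic, leadingCoeff_comp (hh.2.2.trans_ne hb.ne'), hh.1.leadingCoeff, one_pow,
      mul_one] at this
    exact this
  · have := hf.2.1
    rwa [hfg, eval_comp, hh.2.1] at this
  · have := hf.2.2
    rw [hfg, natDegree_comp, hh.2.2] at this
    exact Nat.eq_of_mul_eq_mul_right hb this

/-- `f` has a monic original right component of degree `k`. -/
def HasRightComponent (f : F[X]) (k : ℕ) : Prop :=
  ∃ h ∈ monicOriginal F k, ∃ g : F[X], f = g.comp h

theorem HasRightComponent.comp {h : F[X]} {k : ℕ} (hk : HasRightComponent h k) (g : F[X]) :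
    HasRightComponent (g.comp h) k := by
  obtain ⟨r, hr, u, rfl⟩ := hk
  exact ⟨r, hr, g.comp u, (comp_assoc _ _ _).symm⟩

theorem hasRightComponent_self {f : F[X]} {n : ℕ} (hf : f ∈ monicOriginal F n) :
    HasRightComponent f n :=
  ⟨f, hf, X, X_comp.symm⟩

/-- A single z serves all right components of f at once, so they can be compared inside one field.
-/
theorem exists_laurentSeries_of_tame {n : ℕ} {f : F[X]} (hf : f ∈ monicOriginal F n)
    (hn : (n : F) ≠ 0) : ∃ z : LaurentSeries F, HasLeadingTerm (-1) 1 z ∧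
      (∀ k, k ∣ n → laurentEval z f ∈ multipleSubfield F k) ∧
      ∀ k, ∀ h ∈ monicOriginal F k, ∀ g : F[X], f = g.comp h →
        0 < k ∧ k ∣ n ∧ laurentEval z h ∈ multipleSubfield F k := by
  rw [← hf.2.2] at hn ⊢
  obtain ⟨z, hz, hzf⟩ := exists_laurentEval_eq_single hf.1 hn
  refine ⟨z, hz, fun k hk => ?_, ?_⟩
  · rw [hzf]
    exact hasMultipleSupport_single ((dvd_neg).2 (Int.natCast_dvd_natCast.2 hk)) 1
  rintro k h hh g hg
  have hdeg : f.natDegree = g.natDegree * k := by rw [hg, natDegree_comp, hh.2.2]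
  refine ⟨Nat.pos_of_ne_zero fun h0 => hn (by simp [hdeg, h0]), Dvd.intro_left _ hdeg.symm, ?_⟩
  have := laurentEval_mem_multipleSubfield_of_eq_comp hz hn hzf hh.1 hg
  rwa [hh.2.2] at this

/-- In the tame case, the degrees of right components are closed under greatest common divisors. -/
theorem HasRightComponent.gcd {n : ℕ} {f : F[X]} (hf : f ∈ monicOriginal F n) (hn : (n : F) ≠ 0)
    {a b : ℕ} (ha : HasRightComponent f a) (hb : HasRightComponent f b) :
    HasRightComponent f (Nat.gcd a b) := by
  obtain ⟨z, hz, hfS, hS⟩ := exists_laurentSeries_of_tame hf hn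
  obtain ⟨g, hg, u, hu⟩ := ha
  obtain ⟨h, hh, v, hv⟩ := hb
  obtain ⟨ha0, han, haS⟩ := hS a g hg u hu
  obtain ⟨hb0, hbn, hbS⟩ := hS b h hh v hv
  obtain ⟨w, hw, hwS⟩ := exists_mem_monicOriginal_gcd hz ha0 hb0 hg hh haS hbS
  exact ⟨w, hw, exists_eq_comp_of_mem_multipleSubfield hz hw.1 hw.2.2 hwS f
    (hfS _ ((Nat.gcd_dvd_left a b).trans han))⟩

/-- In the tame case, the degrees of right components are closed under least common multiples. -/
theorem HasRightComponent.lcm {n : ℕ} {f : F[X]} (hf : f ∈ monicOriginal F n) (hn : (n : F) ≠ 0)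
    {a b : ℕ} (ha : HasRightComponent f a) (hb : HasRightComponent f b) :
    HasRightComponent f (Nat.lcm a b) := by
  obtain ⟨z, hz, hfS, hS⟩ := exists_laurentSeries_of_tame hf hn
  obtain ⟨g, hg, u, hu⟩ := ha
  obtain ⟨h, hh, v, hv⟩ := hb
  obtain ⟨ha0, han, haS⟩ := hS a g hg u hu
  obtain ⟨hb0, hbn, hbS⟩ := hS b h hh v hv
  obtain ⟨w, hw, hwS⟩ := exists_mem_monicOriginal_lcm hz ha0 hb0 hg hh haS hbS
  exact ⟨w, hw, exists_eq_comp_of_mem_multipleSubfield hz hw.1 hw.2.2 hwS f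
    (hfS _ (Nat.lcm_dvd han hbn))⟩

/-- In the tame case, a right component of degree `a` is a right component of every right component
whose degree is a multiple of `a`. -/
theorem exists_eq_comp_of_dvd {n : ℕ} {f : F[X]} (hf : f ∈ monicOriginal F n) (hn : (n : F) ≠ 0)
    {a b : ℕ} (hab : a ∣ b) {g h u v : F[X]} (hg : g ∈ monicOriginal F a)
    (hh : h ∈ monicOriginal F b) (hu : f = u.comp g) (hv : f = v.comp h) :
    ∃ w : F[X], h = w.comp g := by
  obtain ⟨z, hz, -, hS⟩ := exists_laurentSeries_of_tame hf hn
  exact exists_eq_comp_of_mem_multipleSubfield hz hg.1 hg.2.2 (hS a g hg u hu).2.2 h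
    (multipleSubfield_mono hab (hS b h hh v hv).2.2)

/-- The composition of a list of polynomials. -/
noncomputable def compList (G : List F[X]) : F[X] :=
  G.foldr (fun a b => a.comp b) X

theorem compList_append (G H : List F[X]) :
    compList (G ++ H) = (compList G).comp (compList H) := by
  induction G with
  | nil => exact X_comp.symm
  | cons g G ih =>
    change g.comp (compList (G ++ H)) = (g.comp (compList G)).comp (compList H)
    rw [ih, comp_assoc]

theorem HasDegreeSequence.forall₂ {d : List ℕ} {g : Fin d.length → F[X]}
    (h : HasDegreeSequence d g) : List.Forall₂ (fun g k => g ∈ monicOriginal F k) (List.ofFn g) d := by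
  rw [List.forall₂_iff_get]
  refine ⟨by simp, fun i hi hi' => ?_⟩
  simpa using h ⟨i, hi'⟩

theorem compList_mem_monicOriginal {G : List F[X]} {d : List ℕ}
    (h : List.Forall₂ (fun g k => g ∈ monicOriginal F k) G d) (hd : ∀ x ∈ d, 0 < x) :
    compList G ∈ monicOriginal F d.prod := by
  induction h with
  | nil => exact X_mem_monicOriginal
  | cons hg _ ih =>
    rw [List.prod_cons]
    have hd' := fun x hx => hd x (List.mem_cons_of_mem _ hx)
    exact comp_mem_monicOriginal (List.prod_pos hd') hg (ih hd')

theorem mem_decomposables_iff {n : ℕ} {d : List ℕ} {f : F[X]} :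
    f ∈ decomposables F n d ↔ f ∈ monicOriginal F n ∧
      ∃ G, List.Forall₂ (fun g k => g ∈ monicOriginal F k) G d ∧ f = compList G := by
  refine and_congr_right fun _ => ⟨?_, ?_⟩
  · rintro ⟨g, hg, rfl⟩
    exact ⟨List.ofFn g, hg.forall₂, rfl⟩
  · rintro ⟨G, hG, rfl⟩
    have hlen := hG.length_eq
    refine ⟨fun i => G.get (i.cast hlen.symm), fun i => ?_, ?_⟩
    · exact (List.forall₂_iff_get.1 hG).2 i.1 (by rw [hlen]; exact i.2) i.2
    · change compList G = compList _
      congr 1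
      refine List.ext_get (by simp [hlen]) fun i hi hi' => ?_
      simp

/-- In the tame case, a decomposition with a given degree sequence exists if and only if there are
right components whose degrees are the products of the final segments of the sequence. -/
theorem mem_decomposables_iff_hasRightComponent {n : ℕ} {d : List ℕ} {f : F[X]}
    (hf : f ∈ monicOriginal F n) (hn : (n : F) ≠ 0) (hd : ∀ x ∈ d, 0 < x) (hdn : d.prod = n) :
    f ∈ decomposables F n d ↔ ∀ s, s <:+ d → HasRightComponent f s.prod := by
  rw [mem_decomposables_iff, and_iff_right hf]
  induction d generalizing f n with
  | nil =>
    rw [List.prod_nil] at hdn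
    subst hdn
    have hfX := eq_X_of_mem_monicOriginal_one hf
    refine ⟨fun _ s hs => ?_, fun _ => ⟨[], List.Forall₂.nil, hfX⟩⟩
    rw [List.suffix_nil.1 hs]
    exact hasRightComponent_self hf
  | cons a d ih =>
    have hd' := fun x hx => hd x (List.mem_cons_of_mem _ hx)
    have hdpos : 0 < d.prod := List.prod_pos hd'
    subst hdn
    rw [List.prod_cons] at hn hf
    have hn' : (d.prod : F) ≠ 0 := by
      rw [Nat.cast_mul] at hn
      exact right_ne_zero_of_mul hn
    constructor
    · rintro ⟨G, hG, rfl⟩ s hs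
      obtain ⟨g, G, hg, hG', rfl⟩ := List.forall₂_cons_right_iff.1 hG
      rcases List.suffix_cons_iff.1 hs with rfl | hs
      · exact hasRightComponent_self hf
      · have hmem := compList_mem_monicOriginal hG' hd'
        exact ((ih hmem hn' hd' rfl).1 ⟨G, hG', rfl⟩ s hs).comp g
    · intro h
      obtain ⟨r, hr, g, hg⟩ := h d (List.suffix_cons a d)
      -- A right component of f whose degree divides deg r is a right component of r, so the
      -- induction hypothesis applies to r.
      obtain ⟨G, hG, hrG⟩ := (ih hr hn' hd' rfl).2 fun s hs => by
        obtain ⟨w, hw, u, hu⟩ := h s (hs.trans (List.suffix_cons a d))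
        have hsd : s.prod ∣ d.prod := by
          obtain ⟨t, rfl⟩ := hs
          rw [List.prod_append]
          exact dvd_mul_left _ _
        exact ⟨w, hw, exists_eq_comp_of_dvd hf hn hsd hw hr hu hg⟩
      refine ⟨g :: G, List.Forall₂.cons (left_mem_monicOriginal hdpos hf hr hg) hG, ?_⟩
      rw [hg, hrG]
      rfl

theorem exists_unique_eq_comp {a b : ℕ} (hab : ((a * b : ℕ) : F) ≠ 0) {g : F[X]}
    (hg : g ∈ monicOriginal F (a * b)) (h : HasRightComponent g b) :
    ∃! uv : F[X] × F[X], uv.1 ∈ monicOriginal F a ∧ uv.2 ∈ monicOriginal F b ∧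
      g = uv.1.comp uv.2 := by
  have hb : 0 < b := Nat.pos_of_ne_zero fun h => hab (by simp [h])
  obtain ⟨v, hv, u, hu⟩ := h
  refine ⟨(u, v), ⟨left_mem_monicOriginal hb hg hv hu, hv, hu⟩, ?_⟩
  rintro ⟨u', v'⟩ ⟨hu', hv', huv'⟩
  dsimp only at hu' hv' huv'
  -- Two right components of equal degree differ by a left factor that is monic original of degree
  -- 1, hence by X.
  obtain ⟨w, hw⟩ := exists_eq_comp_of_dvd hg hab (dvd_refl b) hv hv' hu huv'
  have hv1 : v' ∈ monicOriginal F (1 * b) := by rwa [one_mul]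
  rw [eq_X_of_mem_monicOriginal_one (left_mem_monicOriginal hb hv1 hv hw), X_comp] at hw
  subst hw
  rw [comp_left_injective (hv.2.2.symm ▸ hb) (huv'.symm.trans hu)]

end Decompositions

/-! ### Identities for gcd and lcm of complementary divisors. -/

section GcdIdentities

/-- Passing to the complementary divisor of n exchanges gcd and lcm. -/
theorem gcd_mul_lcm_of_mul_eq {n x y z w : ℕ} (hn : 0 < n) (h : x * y = n) (h' : z * w = n) :
    Nat.gcd x z * Nat.lcm y w = n := by
  have hy : 0 < y := Nat.pos_of_ne_zero fun h0 => by simp [h0] at h; omega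
  have hg : 0 < Nat.gcd y w := Nat.gcd_pos_of_pos_left w hy
  refine Nat.eq_of_mul_eq_mul_right hg ?_
  have h1 : Nat.gcd x z * (y * w) = n * Nat.gcd y w := by
    rw [← Nat.gcd_mul_right, ← mul_assoc, h, mul_left_comm, h', Nat.gcd_comm, mul_comm y n,
      Nat.gcd_mul_left]
  rw [mul_assoc, mul_comm (Nat.lcm y w), Nat.gcd_mul_lcm, h1]

/-- By complementation, gcd(d a', lcm(a', b')) is the cofactor in n of lcm(A, gcd(A d, B)). The
latter is evaluated by gcd · lcm = product. -/
theorem gcd_lcm_mul_gcd {n A d a' B b' : ℕ} (hn : 0 < n) (hA : A * d * a' = n) (hB : B * b' = n) :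
    Nat.gcd (d * a') (Nat.lcm a' b') * Nat.gcd (A * d) B = d * a' * Nat.gcd A B := by
  have hA0 : 0 < A := Nat.pos_of_ne_zero fun h0 => by simp [h0] at hA; omega
  have h1 := gcd_mul_lcm_of_mul_eq hn hA hB
  rw [mul_comm] at h1
  have h2 := gcd_mul_lcm_of_mul_eq hn (x := d * a') (y := A) (by rw [← hA]; ring) h1
  have h3 : Nat.gcd A (Nat.gcd (A * d) B) = Nat.gcd A B := by
    rw [← Nat.gcd_assoc, Nat.gcd_mul_right_right]
  have h4 := Nat.gcd_mul_lcm A (Nat.gcd (A * d) B)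
  rw [h3] at h4
  refine Nat.eq_of_mul_eq_mul_left hA0 ?_
  calc A * (Nat.gcd (d * a') (Nat.lcm a' b') * Nat.gcd (A * d) B)
      = Nat.gcd (d * a') (Nat.lcm a' b') * (A * Nat.gcd (A * d) B) := by ring
    _ = Nat.gcd (d * a') (Nat.lcm a' b') * Nat.lcm A (Nat.gcd (A * d) B) * Nat.gcd A B := by
        rw [← h4]; ring
    _ = A * (d * a' * Nat.gcd A B) := by rw [h2, ← hA]; ring

/-- The hypothesis forces both gcds to equal g = gcd(A, B). With A = A' g and B = B' g, this says
that A' d is coprime to B' and A' to B' e, so only gcd(d, e) survives in gcd(A' d, B' e). -/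
theorem gcd_mul_mul_eq {A d B e : ℕ} (hA : 0 < A)
    (h : Nat.gcd (A * d) B = Nat.gcd A (B * e)) :
    Nat.gcd (A * d) (B * e) = Nat.gcd A (B * e) * Nat.gcd d e := by
  obtain ⟨g, A', B', hg, hcop, hA', hB'⟩ := Nat.exists_coprime' (m := A) (n := B)
    (Nat.gcd_pos_of_pos_left B hA)
  subst hA' hB'
  have hgA : Nat.gcd (A' * g) (B' * g) = g := by
    rw [Nat.gcd_mul_right, hcop, one_mul]
  have h1 : Nat.gcd (A' * g) (B' * g * e) = g := by
    refine Nat.dvd_antisymm ?_ ?_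
    · nth_rewrite 3 [← hgA]
      exact Nat.dvd_gcd (Nat.gcd_dvd_left _ _) (h ▸ Nat.gcd_dvd_right _ _)
    · exact Nat.dvd_gcd (dvd_mul_left _ _) ((dvd_mul_left _ _).mul_right _)
  rw [h1] at h ⊢
  have hg0 : 0 < g := hg
  have h2 : Nat.Coprime (A' * d) B' := by
    refine Nat.eq_of_mul_eq_mul_right hg0 ?_
    rw [one_mul, ← Nat.gcd_mul_right, mul_right_comm]
    exact h
  have h3 : Nat.Coprime A' (B' * e) := by
    refine Nat.eq_of_mul_eq_mul_right hg0 ?_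
    rw [one_mul, ← Nat.gcd_mul_right, mul_right_comm B']
    exact h1
  rw [mul_right_comm A', mul_right_comm B', Nat.gcd_mul_right, mul_comm g,
    Nat.Coprime.gcd_mul_left_cancel d h3, Nat.Coprime.gcd_mul_left_cancel_right e
      h2.coprime_mul_left.symm]

end GcdIdentities

theorem suffix_append_cases {α : Type*} {s L M : List α} (h : s <:+ L ++ M) :
    s <:+ M ∨ ∃ t, t <:+ L ∧ s = t ++ M := by
  obtain ⟨p, hp⟩ := h
  rcases List.append_eq_append_iff.1 hp with ⟨t, rfl, rfl⟩ | ⟨t, rfl, rfl⟩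
  · exact Or.inr ⟨t, ⟨p, rfl⟩, rfl⟩
  · exact Or.inl ⟨t, rfl⟩

/-! ### Splitting a single component. -/

section SplitComponents

variable {F : Type*} [Field F]

theorem take_prod_mul_get_mul_drop_prod (d : List ℕ) (i : Fin d.length) :
    (d.take i).prod * d.get i * (d.drop (i + 1)).prod = d.prod := by
  rw [List.get_eq_getElem, ← List.prod_take_succ d i.1 i.2, List.prod_take_mul_prod_drop]

theorem get_mul_drop_prod (d : List ℕ) (i : Fin d.length) :
    d.get i * (d.drop (i + 1)).prod = (d.drop i).prod := by
  rw [List.get_eq_getElem, List.drop_eq_getElem_cons i.2, List.prod_cons]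

/-- If `f` has right components whose degrees are cofactors of `A * d`
and of `B`, then it has one whose degree is the cofactor of `lcm A (gcd (A * d) B)`. -/
theorem HasRightComponent.of_mul_gcd_eq {n : ℕ} {f : F[X]} (hf : f ∈ monicOriginal F n)
    (hn : (n : F) ≠ 0) {A d a' B b' r : ℕ} (hA : A * d * a' = n) (hB : B * b' = n)
    (h : HasRightComponent f (d * a')) (ha : HasRightComponent f a')
    (hb : HasRightComponent f b') (hr : r * Nat.gcd (A * d) B = d * Nat.gcd A B) :
    HasRightComponent f (r * a') := by
  have hn0 : 0 < n := Nat.pos_of_ne_zero fun h0 => hn (by simp [h0])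
  have h1 := gcd_lcm_mul_gcd hn0 hA hB
  have hpos : 0 < Nat.gcd (A * d) B :=
    Nat.gcd_pos_of_pos_right _ (Nat.pos_of_ne_zero fun h0 => by simp [h0] at hB; omega)
  have h2 : r * a' = Nat.gcd (d * a') (Nat.lcm a' b') := by
    refine Nat.eq_of_mul_eq_mul_right hpos ?_
    rw [h1, mul_right_comm, hr]
    ring
  rw [h2]
  exact h.gcd hf hn (ha.lcm hf hn hb)

theorem hasRightComponent_div_gcd_mul {n : ℕ} (hn : (n : F) ≠ 0) {d e : List ℕ}
    (hd : IsOrderedFactorization n d) (he : IsOrderedFactorization n e) {f : F[X]}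
    (hfd : f ∈ decomposables F n d) (hfe : f ∈ decomposables F n e)
    (i : Fin d.length) (j : Fin e.length)
    (h : Nat.gcd ((d.take i).prod * d.get i) (e.take j).prod =
      Nat.gcd (d.take i).prod ((e.take j).prod * e.get j)) :
    HasRightComponent f (d.get i / Nat.gcd (d.get i) (e.get j) * (d.drop (i + 1)).prod) := by
  have hf := hfd.1
  rw [mem_decomposables_iff_hasRightComponent hf hn (fun x hx => (hd.1 x hx).le) hd.2] at hfd
  rw [mem_decomposables_iff_hasRightComponent hf hn (fun x hx => (he.1 x hx).le) he.2] at hfe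
  -- B includes the entry of e with index j, so its cofactor is the product of the entries after it.
  refine HasRightComponent.of_mul_gcd_eq hf hn (A := (d.take i).prod)
    (B := (e.take j).prod * e.get j) (b' := (e.drop (j + 1)).prod)
    ((take_prod_mul_get_mul_drop_prod d i).trans hd.2)
    ((take_prod_mul_get_mul_drop_prod e j).trans he.2) ?_ (hfd _ (List.drop_suffix _ _))
    (hfe _ (List.drop_suffix _ _)) ?_
  · rw [get_mul_drop_prod]
    exact hfd _ (List.drop_suffix _ _)
  · have hA : 0 < (d.take i).prod :=
      List.prod_pos fun x hx => (zero_lt_one.trans (hd.1 x (List.mem_of_mem_take hx)))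
    rw [gcd_mul_mul_eq hA h, mul_comm (Nat.gcd _ _) (Nat.gcd (d.get i) _), ← mul_assoc,
      Nat.div_mul_cancel (Nat.gcd_dvd_left _ _)]

/-- The entry with index `i` of the degree sequence can be split into `c` and `r` if there is a right
component of the corresponding degree. -/
theorem mem_decomposables_split {n : ℕ} (hn : (n : F) ≠ 0) {d : List ℕ} (hd : ∀ x ∈ d, 0 < x)
    (hdn : d.prod = n) {f : F[X]} (hf : f ∈ decomposables F n d) (i : Fin d.length) {c r : ℕ}
    (hcr : c * r = d.get i) (h : HasRightComponent f (r * (d.drop (i + 1)).prod)) :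
    f ∈ decomposables F n (d.take i ++ [c, r] ++ d.drop (i + 1)) := by
  have hfn := hf.1
  have hpos : 0 < d.get i := hd _ (List.get_mem d i)
  have hc : 0 < c := Nat.pos_of_ne_zero fun h0 => hpos.ne (by rw [← hcr, h0]; simp)
  have hr : 0 < r := Nat.pos_of_ne_zero fun h0 => hpos.ne (by rw [← hcr, h0]; simp)
  rw [mem_decomposables_iff_hasRightComponent hfn hn hd hdn] at hf
  rw [mem_decomposables_iff_hasRightComponent hfn hn]
  · intro s hs
    rcases suffix_append_cases hs with hs | ⟨t, ht, rfl⟩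
    · exact hf s (hs.trans (List.drop_suffix _ _))
    rcases suffix_append_cases ht with ht | ⟨u, hu, rfl⟩
    · rw [List.prod_append]
      rcases List.suffix_cons_iff.1 ht with rfl | ht
      · rw [List.prod_cons, List.prod_cons, List.prod_nil, mul_one, hcr, get_mul_drop_prod]
        exact hf _ (List.drop_suffix _ _)
      rcases List.suffix_cons_iff.1 ht with rfl | ht
      · rwa [List.prod_singleton]
      · rw [List.suffix_nil.1 ht, List.prod_nil, one_mul]
        exact hf _ (List.drop_suffix _ _)
    · rw [List.prod_append, List.prod_append, List.prod_cons, List.prod_cons, List.prod_nil,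
        mul_one, hcr, mul_assoc, get_mul_drop_prod, ← List.prod_append]
      refine hf _ ?_
      obtain ⟨v, hv⟩ := hu
      exact ⟨v, by rw [← List.append_assoc, hv, List.take_append_drop]⟩
  · intro x hx
    simp only [List.mem_append, List.mem_cons, List.not_mem_nil, or_false] at hx
    rcases hx with (hx | rfl | rfl) | hx
    exacts [hd x (List.mem_of_mem_take hx), hc, hr, hd x (List.mem_of_mem_drop hx)]
  · rw [List.prod_append, List.prod_append, List.prod_cons, List.prod_cons, List.prod_nil, mul_one,
      hcr, take_prod_mul_get_mul_drop_prod, hdn]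

theorem compList_ofFn {d : List ℕ} (g : Fin d.length → F[X]) :
    compList (List.ofFn g) = compAll g := rfl

/-- A component of a decomposition splits if the whole composition has a suitable right
component. -/
theorem existsUnique_split_component {n : ℕ} (hn : (n : F) ≠ 0) {d : List ℕ}
    (hd : ∀ x ∈ d, 0 < x) (hdn : d.prod = n) {g : Fin d.length → F[X]}
    (hg : HasDegreeSequence d g) (i : Fin d.length) {c r : ℕ} (hcr : c * r = d.get i)
    (h : HasRightComponent (compAll g) (r * (d.drop (i + 1)).prod)) :
    ∃! uv : F[X] × F[X], uv.1 ∈ monicOriginal F c ∧ uv.2 ∈ monicOriginal F r ∧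
      g i = uv.1.comp uv.2 := by
  have hG := hg.forall₂
  have hf := compList_mem_monicOriginal hG hd
  rw [compList_ofFn, hdn] at hf
  have hdrop : ∀ k, compList ((List.ofFn g).drop k) ∈ monicOriginal F (d.drop k).prod := fun k =>
    compList_mem_monicOriginal (List.forall₂_drop k hG) fun x hx => hd x (List.mem_of_mem_drop hx)
  have hsplit : ∀ k, compAll g =
      (compList ((List.ofFn g).take k)).comp (compList ((List.ofFn g).drop k)) := fun k => by
    rw [← compList_append, List.take_append_drop, compList_ofFn]
  have hgi : compList ((List.ofFn g).drop i) =
      (g i).comp (compList ((List.ofFn g).drop (i + 1))) := by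
    rw [List.drop_eq_getElem_cons (by simp)]
    simp [compList]
  set R := compList ((List.ofFn g).drop (i + 1)) with hR
  have hRm : R ∈ monicOriginal F (d.drop (i + 1)).prod := hdrop (i + 1)
  have hRpos : 0 < (d.drop (i + 1)).prod :=
    List.prod_pos fun x hx => hd x (List.mem_of_mem_drop hx)
  obtain ⟨w, hw, p, hp⟩ := h
  have hcast : ((c * r : ℕ) : F) ≠ 0 := by
    rw [hcr]
    intro h0
    rw [← hdn, ← take_prod_mul_get_mul_drop_prod d i, Nat.cast_mul, Nat.cast_mul, h0, mul_zero,
      zero_mul] at hn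
    exact hn rfl
  have hdvd : r * (d.drop (i + 1)).prod ∣ (d.drop i).prod := by
    rw [← get_mul_drop_prod, ← hcr, mul_assoc]
    exact dvd_mul_left _ _
  -- By degrees, w is a right component of g_i ∘ R, and R is one of w. Cancelling R from g_i ∘ R = u
  -- ∘ w = u ∘ v ∘ R leaves g_i = u ∘ v.
  obtain ⟨u, hu⟩ := exists_eq_comp_of_dvd hf hn hdvd hw (hdrop i) hp (hsplit i)
  obtain ⟨v, hv⟩ := exists_eq_comp_of_dvd hf hn (dvd_mul_left _ _) hRm hw (hsplit (i + 1)) hp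
  refine exists_unique_eq_comp hcast (hcr.symm ▸ hg i) ⟨v, left_mem_monicOriginal hRpos hw hRm hv, u,
    ?_⟩
  refine comp_left_injective (hRm.2.2.symm ▸ hRpos) ?_
  rw [← hgi, hu, hv, comp_assoc]

end SplitComponents

/-! ### Closed forms for the entries and remainders in the algorithm. -/

section Grid

/-- The greatest common divisor of the products of the first `i` entries of `d` and of the first
`j` entries of `e`. -/
def prefixGcd (d e : List ℕ) (i j : ℕ) : ℕ :=
  Nat.gcd (d.take i).prod (e.take j).prod

/-- The final entry with index `(i, j)` of the matrices in the refinement algorithm. -/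
def gridEntry (d e : List ℕ) (i j : ℕ) : ℕ :=
  prefixGcd d e (i + 1) (j + 1) * prefixGcd d e i j /
    (prefixGcd d e i (j + 1) * prefixGcd d e (i + 1) j)

/-- What remains of the entry of `d` with index `i` after `j` steps in the refinement algorithm. -/
def gridRemainder (d e : List ℕ) (i j : ℕ) : ℕ :=
  d.getD i 1 * prefixGcd d e i j / prefixGcd d e (i + 1) j

theorem prefixGcd_comm (d e : List ℕ) (i j : ℕ) : prefixGcd d e i j = prefixGcd e d j i :=
  Nat.gcd_comm _ _

theorem gridEntry_comm (d e : List ℕ) (i j : ℕ) : gridEntry d e i j = gridEntry e d j i := by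
  simp only [gridEntry, prefixGcd_comm d e]
  rw [mul_comm (prefixGcd e d (j + 1) i)]

/-- The default value 1 makes this hold beyond the end of the list. -/
theorem take_succ_prod_eq (d : List ℕ) (i : ℕ) :
    (d.take (i + 1)).prod = (d.take i).prod * d.getD i 1 := by
  by_cases h : i < d.length
  · rw [List.prod_take_succ d i h, List.getD_eq_getElem _ _ h]
  · rw [List.take_of_length_le (by omega), List.take_of_length_le (by omega),
      List.getD_eq_default _ _ (by omega), mul_one]

theorem take_prod_pos {d : List ℕ} (hd : ∀ x ∈ d, 0 < x) (i : ℕ) : 0 < (d.take i).prod :=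
  List.prod_pos fun x hx => hd x (List.mem_of_mem_take hx)

theorem prefixGcd_pos {d : List ℕ} (hd : ∀ x ∈ d, 0 < x) (e : List ℕ) (i j : ℕ) :
    0 < prefixGcd d e i j :=
  Nat.gcd_pos_of_pos_left _ (take_prod_pos hd i)

theorem gridRemainder_mul (d e : List ℕ) (i j : ℕ) :
    gridRemainder d e i j * prefixGcd d e (i + 1) j = d.getD i 1 * prefixGcd d e i j := by
  refine Nat.div_mul_cancel ?_
  rw [prefixGcd, prefixGcd, take_succ_prod_eq, ← Nat.gcd_mul_left]
  exact Nat.dvd_gcd ((Nat.gcd_dvd_left _ _).trans (by rw [mul_comm]))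
    ((Nat.gcd_dvd_right _ _).mul_left _)

/-- The division in `gridEntry` is exact: the lcm of the two factors of the denominator divides
G(i+1,j+1), and their gcd divides G(i,j). -/
theorem gridEntry_mul (d e : List ℕ) (i j : ℕ) :
    gridEntry d e i j * (prefixGcd d e i (j + 1) * prefixGcd d e (i + 1) j) =
      prefixGcd d e (i + 1) (j + 1) * prefixGcd d e i j := by
  refine Nat.div_mul_cancel ?_
  have hi : (d.take i).prod ∣ (d.take (i + 1)).prod := take_succ_prod_eq d i ▸ dvd_mul_right _ _
  have hj : (e.take j).prod ∣ (e.take (j + 1)).prod := take_succ_prod_eq e j ▸ dvd_mul_right _ _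
  rw [← Nat.gcd_mul_lcm, mul_comm]
  refine mul_dvd_mul (Nat.lcm_dvd ?_ ?_) ?_
  · exact Nat.gcd_dvd_gcd_of_dvd_left _ hi
  · exact Nat.gcd_dvd_gcd_of_dvd_right _ hj
  · exact Nat.dvd_gcd ((Nat.gcd_dvd_left _ _).trans (Nat.gcd_dvd_left _ _))
      ((Nat.gcd_dvd_right _ _).trans (Nat.gcd_dvd_right _ _))

theorem gridRemainder_eq_mul {d : List ℕ} (hd : ∀ x ∈ d, 0 < x) (e : List ℕ) (i j : ℕ) :
    gridRemainder d e i j = gridRemainder d e i (j + 1) * gridEntry d e i j := by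
  have h1 := gridRemainder_mul d e i j
  have h2 := gridRemainder_mul d e i (j + 1)
  have h3 := gridEntry_mul d e i j
  have p1 := prefixGcd_pos hd e i (j + 1)
  have p2 := prefixGcd_pos hd e (i + 1) j
  have p3 := prefixGcd_pos hd e (i + 1) (j + 1)
  refine Nat.eq_of_mul_eq_mul_right (Nat.mul_pos (Nat.mul_pos p1 p2) p3) ?_
  calc gridRemainder d e i j *
        (prefixGcd d e i (j + 1) * prefixGcd d e (i + 1) j * prefixGcd d e (i + 1) (j + 1))
      = gridRemainder d e i j * prefixGcd d e (i + 1) j *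
        (prefixGcd d e i (j + 1) * prefixGcd d e (i + 1) (j + 1)) := by ring
    _ = gridRemainder d e i (j + 1) * prefixGcd d e (i + 1) (j + 1) *
        (prefixGcd d e (i + 1) (j + 1) * prefixGcd d e i j) := by rw [h1, h2]; ring
    _ = gridRemainder d e i (j + 1) * gridEntry d e i j *
        (prefixGcd d e i (j + 1) * prefixGcd d e (i + 1) j * prefixGcd d e (i + 1) (j + 1)) := by
      rw [← h3]; ring

theorem gridRemainder_dvd {d : List ℕ} (hd : ∀ x ∈ d, 0 < x) (e : List ℕ) (i j : ℕ) :
    gridRemainder d e i j ∣ (d.take (i + 1)).prod / prefixGcd d e (i + 1) j := by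
  refine Dvd.intro ((d.take i).prod / prefixGcd d e i j) ?_
  refine (Nat.div_eq_of_eq_mul_left (prefixGcd_pos hd e (i + 1) j) ?_).symm
  rw [mul_right_comm, gridRemainder_mul, mul_assoc, prefixGcd,
    Nat.mul_div_cancel' (Nat.gcd_dvd_left _ _), take_succ_prod_eq, mul_comm]

/-- The remainders divide the two prefix products after division by their gcd. -/
theorem coprime_gridRemainder {d e : List ℕ} (hd : ∀ x ∈ d, 0 < x) (he : ∀ x ∈ e, 0 < x)
    (i j : ℕ) :
    Nat.Coprime (gridRemainder d e i (j + 1)) (gridRemainder e d j (i + 1)) := by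
  refine Nat.Coprime.of_dvd (gridRemainder_dvd hd e i (j + 1)) (gridRemainder_dvd he d j (i + 1)) ?_
  rw [prefixGcd_comm e d]
  exact Nat.coprime_div_gcd_div_gcd (prefixGcd_pos hd e _ _)

theorem gridEntry_pos {d : List ℕ} (hd : ∀ x ∈ d, 0 < x) (e : List ℕ) (i j : ℕ) :
    0 < gridEntry d e i j := by
  refine Nat.pos_of_ne_zero fun h => ?_
  have := gridEntry_mul d e i j
  rw [h, zero_mul] at this
  exact (Nat.mul_pos (prefixGcd_pos hd e _ _) (prefixGcd_pos hd e _ _)).ne this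

/-- Both remainders are the entry times their successors, and the successors are coprime. Thus the
gcd taken by the algorithm is the closed form. -/
theorem gcd_gridRemainder {d e : List ℕ} (hd : ∀ x ∈ d, 0 < x) (he : ∀ x ∈ e, 0 < x) (i j : ℕ) :
    Nat.gcd (gridRemainder d e i j) (gridRemainder e d j i) = gridEntry d e i j := by
  rw [gridRemainder_eq_mul hd, gridRemainder_eq_mul he, gridEntry_comm e d, Nat.gcd_mul_right,
    coprime_gridRemainder hd he, one_mul]

theorem gridRemainder_div {d : List ℕ} (hd : ∀ x ∈ d, 0 < x) (e : List ℕ) (i j : ℕ) :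
    gridRemainder d e i j / gridEntry d e i j = gridRemainder d e i (j + 1) := by
  rw [gridRemainder_eq_mul hd, Nat.mul_div_cancel _ (gridEntry_pos hd e i j)]

theorem gridRemainder_zero (d e : List ℕ) (i : ℕ) : gridRemainder d e i 0 = d.getD i 1 := by
  simp [gridRemainder, prefixGcd]

theorem gridRemainder_length {d e : List ℕ} (hd : ∀ x ∈ d, 0 < x) (hde : d.prod = e.prod) (i : ℕ) :
    gridRemainder d e i e.length = 1 := by
  have h : ∀ k, prefixGcd d e k e.length = (d.take k).prod := fun k => by
    rw [prefixGcd, List.take_length, ← hde]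
    exact Nat.gcd_eq_left (List.prod_take_mul_prod_drop d k ▸ dvd_mul_right _ _)
  rw [gridRemainder, h, h, take_succ_prod_eq, mul_comm]
  refine Nat.div_self ?_
  rw [← take_succ_prod_eq]
  exact take_prod_pos hd _

theorem gridRemainder_dvd_of_le {d : List ℕ} (hd : ∀ x ∈ d, 0 < x) (e : List ℕ) (i : ℕ) {j j' : ℕ}
    (h : j ≤ j') : gridRemainder d e i j' ∣ gridRemainder d e i j := by
  induction j', h using Nat.le_induction with
  | base => exact dvd_rfl
  | succ k _ ih => exact (Dvd.intro _ (gridRemainder_eq_mul hd e i k).symm).trans ih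

/-- The entry at (i,j) divides what remains of d_i after column j', and the entry at (i',j') what
remains of e_{j'} after row i. These remainders are coprime. -/
theorem coprime_gridEntry {d e : List ℕ} (hd : ∀ x ∈ d, 0 < x) (he : ∀ x ∈ e, 0 < x)
    {i j i' j' : ℕ} (hi : i < i') (hj : j' < j) :
    Nat.Coprime (gridEntry d e i j) (gridEntry d e i' j') := by
  refine Nat.Coprime.of_dvd ?_ ?_ (coprime_gridRemainder hd he i j')
  · exact (Dvd.intro_left _ (gridRemainder_eq_mul hd e i j).symm).trans
      (gridRemainder_dvd_of_le hd e i hj)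
  · rw [gridEntry_comm]
    exact (Dvd.intro_left _ (gridRemainder_eq_mul he d j' i').symm).trans
      (gridRemainder_dvd_of_le he d j' hi)

theorem prod_map_drop_range_gridEntry {d e : List ℕ} (hd : ∀ x ∈ d, 0 < x)
    (hde : d.prod = e.prod) (i : ℕ) {j : ℕ} (hj : j ≤ e.length) :
    ((((List.range e.length).drop j)).map (gridEntry d e i)).prod = gridRemainder d e i j := by
  induction hj using Nat.decreasingInduction with
  | self =>
    rw [List.drop_of_length_le (by simp), List.map_nil, List.prod_nil, gridRemainder_length hd hde]
  | of_succ k hk ih =>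
    rw [List.drop_eq_getElem_cons (by simpa using hk), List.map_cons, List.prod_cons, ih,
      List.getElem_range, gridRemainder_eq_mul hd e i k, mul_comm]

end Grid

/-! ### Loop invariant and operation count. -/

section Algorithm

/-- Loop invariant rule: P j is the value together with the counter after j steps. It serves for
both the inner and the outer loop. -/
theorem foldlM_finRange_run {σ α : Type} (m : ℕ) (f : α → Fin m → StateM σ α) (P : ℕ → α × σ)
    (h : ∀ j : Fin m, f (P j).1 j (P j).2 = P (j + 1)) :
    (List.finRange m).foldlM f (P 0).1 (P 0).2 = P m := by
  induction m generalizing P with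
  | zero => simp [List.finRange_zero]; rfl
  | succ m ih =>
    rw [List.finRange_succ, List.foldlM_cons]
    change (List.foldlM f (f (P 0).1 0 (P 0).2).1 (List.map Fin.succ (List.finRange m)))
      (f (P 0).1 0 (P 0).2).2 = _
    have h0 := h 0
    rw [Fin.val_zero] at h0
    rw [h0, List.foldlM_map]
    exact ih (fun a j => f a j.succ) (fun j => P (j + 1)) fun j => h j.succ

/-- The matrices of the refinement algorithm after `i` complete rows and `j` more steps. -/
def gridState (d e : List ℕ) (i j : ℕ) : RefineState d.length e.length where
  ds i' j' :=
    if j' = Fin.last e.length then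
      gridRemainder d e i' (if i'.1 < i then e.length else if i'.1 = i then j else 0)
    else if i'.1 < i ∨ i'.1 = i ∧ j'.1 < j then gridEntry d e i' j' else 1
  es j' i' :=
    if i' = Fin.last d.length then gridRemainder e d j' (if j'.1 < j then i + 1 else i)
    else if i'.1 < i ∨ i'.1 = i ∧ j'.1 < j then gridEntry d e i' j' else 1

theorem refineInit_eq (d e : List ℕ) : refineInit d e = gridState d e 0 0 := by
  unfold refineInit gridState
  congr 1
  · funext i j
    simp only [Nat.not_lt_zero, if_false, and_false, or_false, ite_self, gridRemainder_zero,
      List.getD_eq_getElem _ _ i.2, List.get_eq_getElem]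
  · funext j i
    simp only [Nat.not_lt_zero, if_false, and_false, or_false, gridRemainder_zero,
      List.getD_eq_getElem _ _ j.2, List.get_eq_getElem]

theorem gridState_length (d e : List ℕ) (i : ℕ) :
    gridState d e i e.length = gridState d e (i + 1) 0 := by
  unfold gridState
  congr 1
  · funext i' j'
    have hi' := i'.2
    have hj' := j'.2
    grind [Fin.ext_iff]
  · funext j' i'
    have hi' := i'.2
    have hj' := j'.2
    grind [Fin.ext_iff]

theorem refineStep_gridState {d e : List ℕ} (hd : ∀ x ∈ d, 0 < x) (he : ∀ x ∈ e, 0 < x)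
    (i : Fin d.length) (j : Fin e.length) (s : OpCount) :
    refineStep i (gridState d e i j) j s =
      (gridState d e i (j + 1), ⟨s.gcds + 1, s.divs + 2⟩) := by
  have hD : (gridState d e i j).ds i (Fin.last e.length) = gridRemainder d e i j := by
    simp [gridState]
  have hE : (gridState d e i j).es j (Fin.last d.length) = gridRemainder e d j i := by
    simp [gridState]
  change ((⟨setEntry (setEntry (gridState d e i j).ds i j.castSucc _) i (Fin.last e.length) _,
    setEntry (setEntry (gridState d e i j).es j i.castSucc _) j (Fin.last d.length) _⟩ :
      RefineState d.length e.length), (⟨s.gcds + 1, s.divs + 2⟩ : OpCount)) = _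
  rw [hD, hE, gcd_gridRemainder hd he, gridRemainder_div hd, gridEntry_comm, gridRemainder_div he,
    gridEntry_comm e d]
  congr 1
  unfold gridState setEntry
  congr 1
  · funext i' j'
    have hj := j.2
    have hj' := j'.2
    simp only [Function.update_apply]
    grind [Fin.ext_iff]
  · funext j' i'
    have hj := j.2
    have hi' := i'.2
    simp only [Function.update_apply]
    grind [Fin.ext_iff]

/-- The entries of an `l × m` matrix, read row by row, without the ones. -/
def readGrid (C : ℕ → ℕ → ℕ) (l m : ℕ) : List ℕ :=
  ((List.range l).flatMap fun i => (List.range m).map (C i)).filter (fun x => x ≠ 1)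

theorem readOff_eq_readGrid {r s : ℕ} (A : Fin r → Fin (s + 1) → ℕ) (C : ℕ → ℕ → ℕ)
    (h : ∀ i j, A i (Fin.castSucc j) = C i j) : readOff A = readGrid C r s := by
  unfold readOff readGrid
  rw [← List.map_coe_finRange_eq_range (n := r), ← List.map_coe_finRange_eq_range (n := s),
    List.flatMap_map]
  simp only [h, List.map_map, Function.comp_def]

theorem run_refineAlgorithm {d e : List ℕ} (hd : ∀ x ∈ d, 0 < x) (he : ∀ x ∈ e, 0 < x) :
    StateT.run (refineAlgorithm d e) ⟨0, 0⟩ =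
      ((readGrid (gridEntry d e) d.length e.length, readGrid (gridEntry e d) e.length d.length),
        (⟨d.length * e.length, 2 * (d.length * e.length)⟩ : OpCount)) := by
  have hrow : ∀ i : Fin d.length,
      (List.finRange e.length).foldlM (refineStep i) (gridState d e i 0)
        ⟨i * e.length, 2 * (i * e.length)⟩ =
      (gridState d e (i + 1) 0,
        (⟨(i + 1) * e.length, 2 * ((i + 1) * e.length)⟩ : OpCount)) := by
    intro i
    rw [← gridState_length, add_mul, one_mul]
    refine foldlM_finRange_run e.length (refineStep i) (fun j => (gridState d e i j,
      (⟨i * e.length + j, 2 * (i * e.length + j)⟩ : OpCount))) fun j => ?_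
    dsimp only
    rw [refineStep_gridState hd he]
    rfl
  have hloop : refineLoop (refineInit d e) ⟨0, 0⟩ = (gridState d e d.length 0,
      (⟨d.length * e.length, 2 * (d.length * e.length)⟩ : OpCount)) := by
    rw [refineInit_eq]
    have := foldlM_finRange_run d.length
      (fun S i => (List.finRange e.length).foldlM (refineStep i) S)
      (fun i => (gridState d e i 0, (⟨i * e.length, 2 * (i * e.length)⟩ : OpCount))) hrow
    simp only [zero_mul, mul_zero] at this
    exact this
  change (((readOff (refineLoop (refineInit d e) ⟨0, 0⟩).1.ds,
    readOff (refineLoop (refineInit d e) ⟨0, 0⟩).1.es)), (refineLoop (refineInit d e) ⟨0, 0⟩).2) = _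
  rw [hloop]
  refine Prod.ext (Prod.ext ?_ ?_) rfl
  · refine readOff_eq_readGrid _ _ fun i j => ?_
    simp [gridState, (Fin.castSucc_lt_last j).ne]
  · refine readOff_eq_readGrid _ _ fun j i => ?_
    simp [gridState, (Fin.castSucc_lt_last i).ne, gridEntry_comm e d]

end Algorithm

/-! ### The outputs as associated refinements. -/

section Refinements

/-- A final segment of a concatenation of blocks. -/
theorem suffix_flatten_cases {α : Type*} {s : List α} {blocks : List (List α)}
    (h : s <:+ blocks.flatten) : s = [] ∨ ∃ (i : ℕ) (hi : i < blocks.length) (t : List α),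
      t <:+ blocks[i] ∧ s = t ++ (blocks.drop (i + 1)).flatten := by
  induction blocks with
  | nil => exact Or.inl (List.suffix_nil.1 h)
  | cons b blocks ih =>
    rw [List.flatten_cons] at h
    rcases suffix_append_cases h with h | ⟨t, ht, rfl⟩
    · refine (ih h).imp_right ?_
      rintro ⟨i, hi, t, ht, rfl⟩
      exact ⟨i + 1, by simpa using hi, t, by simpa using ht, by simp⟩
    · exact Or.inr ⟨0, by simp, t, ht, by simp⟩

theorem prod_filter_ne_one (l : List ℕ) : (l.filter fun x => x ≠ 1).prod = l.prod := by
  induction l with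
  | nil => rfl
  | cons a l ih =>
    by_cases h : a = 1
    · rw [List.filter_cons_of_neg (by simpa using h), ih, List.prod_cons, h, one_mul]
    · rw [List.filter_cons_of_pos (by simpa using h), List.prod_cons, List.prod_cons, ih]

/-- The rows of the matrix `C` without the ones. -/
def gridBlocks (C : ℕ → ℕ → ℕ) (l m : ℕ) : List (List ℕ) :=
  (List.range l).map fun i => ((List.range m).map (C i)).filter fun x => x ≠ 1

theorem readGrid_eq_flatten (C : ℕ → ℕ → ℕ) (l m : ℕ) :
    readGrid C l m = (gridBlocks C l m).flatten := by
  rw [readGrid, List.filter_flatMap, List.flatMap_def]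
  rfl

theorem map_prod_gridBlocks {d e : List ℕ} (hd : ∀ x ∈ d, 0 < x) (hde : d.prod = e.prod) :
    (gridBlocks (gridEntry d e) d.length e.length).map List.prod = d := by
  refine List.ext_getElem (by simp [gridBlocks]) fun i hi hi' => ?_
  have := prod_map_drop_range_gridEntry hd hde i (Nat.zero_le e.length)
  rw [List.drop_zero] at this
  simp only [gridBlocks, List.map_map, List.getElem_map, List.getElem_range, Function.comp_apply]
  rw [prod_filter_ne_one, this, gridRemainder_zero, List.getD_eq_getElem _ _ hi']

theorem one_lt_of_mem_readGrid {d e : List ℕ} (hd : ∀ x ∈ d, 0 < x) {l m x : ℕ}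
    (hx : x ∈ readGrid (gridEntry d e) l m) : 1 < x := by
  simp only [readGrid, List.mem_filter, List.mem_flatMap, List.mem_map] at hx
  obtain ⟨⟨i, -, j, -, rfl⟩, h⟩ := hx
  have := gridEntry_pos hd e i j
  simp only [ne_eq, decide_not, Bool.not_eq_true', decide_eq_false_iff_not] at h
  omega

theorem isRefinement_readGrid {n : ℕ} {d e : List ℕ} (hd : IsOrderedFactorization n d)
    (he : IsOrderedFactorization n e) :
    IsRefinement n (readGrid (gridEntry d e) d.length e.length) d := by
  have hd0 : ∀ x ∈ d, 0 < x := fun x hx => (hd.1 x hx).le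
  have hmap := map_prod_gridBlocks hd0 (hd.2.trans he.2.symm)
  refine ⟨⟨fun x hx => one_lt_of_mem_readGrid hd0 hx, ?_⟩, _, readGrid_eq_flatten _ _ _, hmap.symm⟩
  rw [readGrid_eq_flatten, List.prod_flatten, hmap, hd.2]

/-- The bijection matches equal labels. If it reverses two positions, their labels stand in opposite
order under r and s, so the weights are coprime. Equal weights exceed 1 and are never coprime, so
their order is preserved too. -/
theorem areAssociated_map {α : Type*} [DecidableEq α] {L M : List α} {w : α → ℕ}
    {r s : α → α → Prop} (hr : ∀ x, ¬ r x x) (hs : ∀ x, ¬ s x x) (hL : L.Pairwise r)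
    (hM : M.Pairwise s) (hLM : ∀ x, x ∈ L ↔ x ∈ M) (hw : ∀ x ∈ L, 1 < w x)
    (h : ∀ x y, r x y → s y x → Nat.Coprime (w x) (w y)) :
    AreAssociated (L.map w) (M.map w) := by
  have hLn : L.Nodup := hL.imp fun {x y} hxy (hne : x = y) => hr x (by rwa [← hne] at hxy)
  have hMn : M.Nodup := hM.imp fun {x y} hxy (hne : x = y) => hs x (by rwa [← hne] at hxy)
  let σ : Fin L.length ≃ Fin M.length := (hLn.getEquiv L).trans
    ((Equiv.subtypeEquivRight hLM).trans (hMn.getEquiv M).symm)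
  have hσ : ∀ i, M.get (σ i) = L.get i := by
    intro i
    have h1 : (hMn.getEquiv M) (σ i) = (Equiv.subtypeEquivRight hLM) (hLn.getEquiv L i) :=
      (hMn.getEquiv M).apply_symm_apply _
    exact congrArg Subtype.val h1
  have hmono : ∀ i j, i < j → 1 < Nat.gcd (w (L.get i)) (w (L.get j)) → σ i < σ j := by
    intro i j hij hgcd
    by_contra hlt
    have hne : σ i ≠ σ j := fun he => hij.ne (σ.injective he)
    have hlt' : σ j < σ i := lt_of_le_of_ne (not_lt.1 hlt) hne.symm
    have h1 : r (L.get i) (L.get j) := List.pairwise_iff_get.1 hL i j hij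
    have h2 := List.pairwise_iff_get.1 hM _ _ hlt'
    rw [hσ, hσ] at h2
    exact hgcd.ne' (h _ _ h1 h2)
  let cL : Fin (L.map w).length ≃ Fin L.length := finCongr (List.length_map w)
  let cM : Fin M.length ≃ Fin (M.map w).length := finCongr (List.length_map w).symm
  have hgetL : ∀ i, (L.map w).get i = w (L.get (cL i)) := fun i => by simp [cL]
  have hget : ∀ i, (L.map w).get i = (M.map w).get ((cL.trans (σ.trans cM)) i) := by
    intro i
    rw [hgetL, ← hσ]
    simp [cM]
  have hlt : ∀ i j, i < j → 1 < Nat.gcd ((L.map w).get i) ((L.map w).get j) →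
      (cL.trans (σ.trans cM)) i < (cL.trans (σ.trans cM)) j := by
    intro i j hij hgcd
    rw [hgetL, hgetL] at hgcd
    exact hmono (cL i) (cL j) hij hgcd
  refine ⟨cL.trans (σ.trans cM), hget, fun i j hij heq => hlt i j hij ?_, hlt⟩
  rw [← heq, Nat.gcd_self, hgetL]
  exact hw _ (List.get_mem _ _)

/-- The labels are the positions (i,j) with entry different from 1, sorted by rows in one list and
by columns in the other. The two orders disagree only on positions in opposite relative position,
where `coprime_gridEntry` applies. -/
theorem areAssociated_readGrid {d e : List ℕ} (hd : ∀ x ∈ d, 0 < x) (he : ∀ x ∈ e, 0 < x) :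
    AreAssociated (readGrid (gridEntry d e) d.length e.length)
      (readGrid (gridEntry e d) e.length d.length) := by
  let L : List (ℕ × ℕ) := ((List.range d.length).flatMap fun i =>
    (List.range e.length).map fun j => (i, j)).filter fun p => gridEntry d e p.1 p.2 ≠ 1
  let M : List (ℕ × ℕ) := ((List.range e.length).flatMap fun j =>
    (List.range d.length).map fun i => (i, j)).filter fun p => gridEntry d e p.1 p.2 ≠ 1
  have h1 : readGrid (gridEntry d e) d.length e.length =
      L.map fun p => gridEntry d e p.1 p.2 := by
    simp only [readGrid, L, List.filter_flatMap, List.map_flatMap, List.filter_map, List.map_map,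
      Function.comp_def]
  have h2 : readGrid (gridEntry e d) e.length d.length =
      M.map fun p => gridEntry d e p.1 p.2 := by
    rw [show gridEntry e d = fun j i => gridEntry d e i j from
      funext fun j => funext fun i => gridEntry_comm e d j i]
    simp only [readGrid, M, List.filter_flatMap, List.map_flatMap, List.filter_map, List.map_map,
      Function.comp_def]
  rw [h1, h2]
  refine areAssociated_map (r := fun p q => p.1 < q.1 ∨ p.1 = q.1 ∧ p.2 < q.2)
    (s := fun p q => p.2 < q.2 ∨ p.2 = q.2 ∧ p.1 < q.1) (by simp) (by simp) ?_ ?_ ?_ ?_ ?_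
  · refine List.Pairwise.filter _ (List.pairwise_flatMap.2 ⟨fun i _ => ?_, ?_⟩)
    · rw [List.pairwise_map]
      exact List.pairwise_lt_range.imp fun h => Or.inr ⟨rfl, h⟩
    · refine List.pairwise_lt_range.imp fun h x hx y hy => ?_
      simp only [List.mem_map] at hx hy
      obtain ⟨_, -, rfl⟩ := hx
      obtain ⟨_, -, rfl⟩ := hy
      exact Or.inl h
  · refine List.Pairwise.filter _ (List.pairwise_flatMap.2 ⟨fun i _ => ?_, ?_⟩)
    · rw [List.pairwise_map]
      exact List.pairwise_lt_range.imp fun h => Or.inr ⟨rfl, h⟩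
    · refine List.pairwise_lt_range.imp fun h x hx y hy => ?_
      simp only [List.mem_map] at hx hy
      obtain ⟨_, -, rfl⟩ := hx
      obtain ⟨_, -, rfl⟩ := hy
      exact Or.inl h
  · rintro ⟨i, j⟩
    have hmem : ∀ k k' : ℕ, (∃ a < k, ∃ b < k', (a, b) = (i, j)) ↔ i < k ∧ j < k' := by
      simp only [Prod.mk.injEq]
      exact fun k k' => ⟨fun ⟨a, ha, b, hb, h3, h4⟩ => ⟨h3 ▸ ha, h4 ▸ hb⟩,
        fun ⟨h3, h4⟩ => ⟨i, h3, j, h4, rfl, rfl⟩⟩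
    have hmem' : ∀ k k' : ℕ, (∃ b < k', ∃ a < k, (a, b) = (i, j)) ↔ i < k ∧ j < k' := by
      simp only [Prod.mk.injEq]
      exact fun k k' => ⟨fun ⟨b, hb, a, ha, h3, h4⟩ => ⟨h3 ▸ ha, h4 ▸ hb⟩,
        fun ⟨h3, h4⟩ => ⟨j, h4, i, h3, rfl, rfl⟩⟩
    simp only [L, M, List.mem_filter, List.mem_flatMap, List.mem_map, List.mem_range, hmem, hmem']
  · rintro ⟨i, j⟩ hp
    have h3 := (List.mem_filter.1 hp).2
    have := gridEntry_pos hd e i j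
    simp only [ne_eq, decide_not, Bool.not_eq_true', decide_eq_false_iff_not] at h3
    change 1 < gridEntry d e i j
    omega
  · rintro ⟨i, j⟩ ⟨i', j'⟩ h3 h4
    dsimp only at h3 h4
    exact coprime_gridEntry hd he (by omega) (by omega)

end Refinements

/-! ### Collisions under refinement, and the proposition. -/

section Collisions

variable {F : Type*} [Field F]

/-- Products of final segments of d are products of final segments of its refinement. -/
theorem decomposables_subset_of_isRefinement {n : ℕ} (hn : (n : F) ≠ 0) {d ds : List ℕ}
    (hd : IsOrderedFactorization n d) (h : IsRefinement n ds d) :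
    decomposables F n ds ⊆ decomposables F n d := by
  intro f hf
  have hfn := hf.1
  obtain ⟨hds, blocks, rfl, rfl⟩ := h
  rw [mem_decomposables_iff_hasRightComponent hfn hn (fun x hx => (hds.1 x hx).le) hds.2] at hf
  rw [mem_decomposables_iff_hasRightComponent hfn hn (fun x hx => (hd.1 x hx).le) hd.2]
  intro s hs
  obtain ⟨t, ht, rfl⟩ := List.suffix_map_iff.1 hs
  rw [← List.prod_flatten]
  obtain ⟨u, rfl⟩ := ht
  exact hf _ ⟨u.flatten, by rw [List.flatten_append]⟩

theorem mem_decomposables_readGrid {n : ℕ} (hn : (n : F) ≠ 0) {d e : List ℕ}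
    (hd : IsOrderedFactorization n d) (he : IsOrderedFactorization n e) {f : F[X]}
    (hfd : f ∈ decomposables F n d) (hfe : f ∈ decomposables F n e) :
    f ∈ decomposables F n (readGrid (gridEntry d e) d.length e.length) := by
  have hf := hfd.1
  have hd0 : ∀ x ∈ d, 0 < x := fun x hx => (hd.1 x hx).le
  have hde : d.prod = e.prod := hd.2.trans he.2.symm
  have hR := (isRefinement_readGrid hd he).1
  rw [mem_decomposables_iff_hasRightComponent hf hn hd0 hd.2] at hfd
  rw [mem_decomposables_iff_hasRightComponent hf hn (fun x hx => (he.1 x hx).le) he.2] at hfe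
  rw [mem_decomposables_iff_hasRightComponent hf hn (fun x hx => (hR.1 x hx).le) hR.2]
  intro s hs
  rw [readGrid_eq_flatten] at hs
  have hmap := map_prod_gridBlocks hd0 hde
  rcases suffix_flatten_cases hs with rfl | ⟨i, hi, t, ht, rfl⟩
  · exact hfd _ (List.nil_suffix)
  have hid : i < d.length := by simpa [gridBlocks] using hi
  rw [List.prod_append, List.prod_flatten, List.map_drop, hmap]
  simp only [gridBlocks, List.getElem_map, List.getElem_range] at ht
  obtain ⟨u, hu, rfl⟩ : ∃ u, u <:+ (List.range e.length).map (gridEntry d e i) ∧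
      t = u.filter fun x => x ≠ 1 := List.suffix_filter_iff.1 ht
  -- A nonempty final segment consists of row i from some column j on, up to ones, and all later
  -- rows. Its product is the remainder of d_i after j steps times the later entries of d.
  obtain ⟨j, hj, rfl⟩ : ∃ j ≤ e.length, u = ((List.range e.length).map (gridEntry d e i)).drop j :=
    ⟨_, (Nat.sub_le _ _).trans (by simp), List.suffix_iff_eq_drop.1 hu⟩
  rw [prod_filter_ne_one, ← List.map_drop, prod_map_drop_range_gridEntry hd0 hde i hj]
  have hmul := gridRemainder_mul d e i j
  rw [prefixGcd, take_succ_prod_eq, List.getD_eq_getElem _ _ hid] at hmul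
  refine HasRightComponent.of_mul_gcd_eq hf hn
    ((take_prod_mul_get_mul_drop_prod d ⟨i, hid⟩).trans hd.2)
    ((List.prod_take_mul_prod_drop e j).trans he.2) ?_ (hfd _ (List.drop_suffix _ _))
    (hfe _ (List.drop_suffix _ _)) hmul
  rw [get_mul_drop_prod d ⟨i, hid⟩]
  exact hfd _ (List.drop_suffix _ _)

theorem collisions_pair (n : ℕ) (d e : List ℕ) :
    collisions F n {d, e} = decomposables F n d ∩ decomposables F n e := by
  rw [collisions, Set.biInter_pair]

end Collisions

theorem proposition3p8 {F : Type*} [Field F] (n : ℕ) (hn : 0 < n) (d e : List ℕ)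
    (hd : IsOrderedFactorization n d) (he : IsOrderedFactorization n e) :
    -- The algorithm works as specified, within the stated number of operations.
    (refineOutput d e = (refineBy d e, refineBy e d) ∧
      IsRefinement n (refineBy d e) d ∧
      IsRefinement n (refineBy e d) e ∧
      AreAssociated (refineBy d e) (refineBy e d) ∧
      (refineCost d e).gcds ≤ d.length * e.length ∧
      (refineCost d e).divs ≤ 2 * (d.length * e.length)) ∧
    -- In the tame case:
    ((n : F) ≠ 0 →
      -- the sets of collisions agree;
      (collisions F n {d, e} = collisions F n {refineBy d e, e} ∧
        collisions F n {refineBy d e, e} = collisions F n {refineBy d e, refineBy e d}) ∧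
      -- single components split along gcds.
      (∀ (i : Fin d.length) (j : Fin e.length),
        Nat.gcd ((d.take i).prod * d.get i) (e.take j).prod =
            Nat.gcd (d.take i).prod ((e.take j).prod * e.get j) →
          (∀ (g : Fin d.length → Polynomial F) (h : Fin e.length → Polynomial F),
            HasDegreeSequence d g → HasDegreeSequence e h → compAll g = compAll h →
            ∃! uv : Polynomial F × Polynomial F,
              uv.1 ∈ monicOriginal F (Nat.gcd (d.get i) (e.get j)) ∧
              uv.2 ∈ monicOriginal F (d.get i / Nat.gcd (d.get i) (e.get j)) ∧
              g i = uv.1.comp uv.2) ∧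
          collisions F n {d, e} ⊆
            decomposables F n (d.take i ++
              [Nat.gcd (d.get i) (e.get j), d.get i / Nat.gcd (d.get i) (e.get j)] ++
              d.drop (i + 1)))) := by
  have hd0 : ∀ x ∈ d, 0 < x := fun x hx => (hd.1 x hx).le
  have he0 : ∀ x ∈ e, 0 < x := fun x hx => (he.1 x hx).le
  have hrun := run_refineAlgorithm hd0 he0
  have hout : refineOutput d e = (readGrid (gridEntry d e) d.length e.length,
      readGrid (gridEntry e d) e.length d.length) := congrArg Prod.fst hrun
  have hbyd : refineBy d e = readGrid (gridEntry d e) d.length e.length := congrArg Prod.fst hout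
  have hbye : refineBy e d = readGrid (gridEntry e d) e.length d.length :=
    congrArg (fun p => p.1.1) (run_refineAlgorithm he0 hd0)
  have hcost : refineCost d e = ⟨d.length * e.length, 2 * (d.length * e.length)⟩ :=
    congrArg Prod.snd hrun
  have hrd := isRefinement_readGrid hd he
  have hre := isRefinement_readGrid he hd
  rw [hout, hcost, hbyd, hbye]
  refine ⟨⟨rfl, hrd, hre, areAssociated_readGrid hd0 he0, le_rfl, le_rfl⟩, fun hnF => ?_⟩
  have hsubd := decomposables_subset_of_isRefinement hnF hd hrd
  have hsube := decomposables_subset_of_isRefinement hnF he hre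
  refine ⟨⟨?_, ?_⟩, fun i j hij => ⟨fun g h hg hh hgh => ?_, ?_⟩⟩
  · rw [collisions_pair, collisions_pair]
    exact Set.Subset.antisymm
      (fun f hf => ⟨mem_decomposables_readGrid hnF hd he hf.1 hf.2, hf.2⟩)
      (fun f hf => ⟨hsubd hf.1, hf.2⟩)
  · rw [collisions_pair, collisions_pair]
    exact Set.Subset.antisymm
      -- The refinement of d is first coarsened to d, and then the roles of d and e are exchanged.
      (fun f hf => ⟨hf.1, mem_decomposables_readGrid hnF he hd hf.2 (hsubd hf.1)⟩)
      (fun f hf => ⟨hf.1, hsube hf.2⟩)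
  · have hf : compAll g ∈ monicOriginal F n := by
      rw [← compList_ofFn, ← hd.2]
      exact compList_mem_monicOriginal hg.forall₂ hd0
    exact existsUnique_split_component hnF hd0 hd.2 hg i
      (Nat.mul_div_cancel' (Nat.gcd_dvd_left _ _))
      (hasRightComponent_div_gcd_mul hnF hd he ⟨hf, g, hg, rfl⟩ ⟨hf, h, hh, hgh⟩ i j hij)
  · rw [collisions_pair]
    rintro f ⟨hfd, hfe⟩
    exact mem_decomposables_split hnF hd0 hd.2 hfd i
      (Nat.mul_div_cancel' (Nat.gcd_dvd_left _ _))
      (hasRightComponent_div_gcd_mul hnF hd he hfd hfe i j hij)
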